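/- Let $L^2(\mathbb{R}^+)$ be the space of complex-valued square integrable functions on $\mathbb{R}^+=(0,\infty)$, and let $\mathscr{F}_{\mathbb{R}^+}:L^2(\mathbb{R}^+)\to L^2(\mathbb{R}^+)$ be the truncated Fourier operator $$(\mathscr{F}_{\mathbb{R}^+}x)(t)=\frac{1}{\sqrt{2\pi}}\int_{\mathbb{R}^+}x(\xi)e^{it\xi}\,d\xi,\qquad t\in\mathbb{R}^+,$$ that is, $\mathscr{F}_{\mathbb{R}^+}=P\mathscr{F}P|_{L^2(\mathbb{R}^+)}$, where $\mathscr{F}$ is the unitary Fourier–Plancherel operator $(\mathscr{F}x)(t)=\frac{1}{\sqrt{2\pi}}\int_{\mathbb{R}}x(\xi)e^{it\xi}\,d\xi$ on $L^2(\mathbb{R})$ and $P$ is the orthogonal projector of $L^2(\mathbb{R})$ onto $L^2(\mathbb{R}^+)$. For $\mu\in[0,\infty)$ let $$F(\mu)=\begin{bmatrix}0&F_{+-}(\mu)\\F_{-+}(\mu)&0\end{bmatrix},\qquad F_{+-}(\mu)=\tfrac{1}{\sqrt{2\pi}}e^{i\pi/4}e^{-\pi\mu/2}\,\Gamma(\tfrac12+i\mu),\quad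 F_{-+}(\mu)=\tfrac{1}{\sqrt{2\pi}}e^{i\pi/4}e^{\pi\mu/2}\,\Gamma(\tfrac12-i\mu),$$ and let $\mathcal{M}_F$ be the operator of multiplication $(\mathcal{M}_Fy)(\mu)=F(\mu)y(\mu)$ on the space $L^2(\mathbb{R}^+)\oplus L^2(\mathbb{R}^+)$ of columns $y=\begin{bmatrix}y_+\\y_-\end{bmatrix}$. Put $\zeta(\mu)=e^{i\pi/4}(2\cosh\pi\mu)^{-1/2}$ for $\mu\in[0,\infty)$ and $\zeta(\infty)=\lim_{\mu\to\infty}\zeta(\mu)=0$, and let $F(\infty)$ be the Jordan cell $\begin{bmatrix}0&0\\1&0\end{bmatrix}$, whose entries are the limits of the moduli of the entries of $F(\mu)$ as $\mu\to\infty$. For $a,b\in\mathbb{C}$ write $[a,b]=\{(1-\tau)a+\tau b:0\le\tau\le1\}$. Then: 1. $\displaystyle \sigma(\mathcal{M}_F)=\Big[-\tfrac{1}{\sqrt2}e^{i\pi/4},\,\tfrac{1}{\sqrt2}e^{i\pi/4}\Big]$; 2. $\displaystyle \sigma(\mathscr{F}_{\mathbb{R}^+})=\Big[-\tfrac{1}{\sqrt2}e^{i\pi/4},\,\tfrac{1}{\sqrt2}e^{i\pi/4}\Big]$;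 3. $\sigma(F(\mu))=\{\zeta(\mu),-\zeta(\mu)\}$ for every $\mu\in[0,\infty]$, and $\displaystyle \sigma(\mathcal{M}_F)=\bigcup_{\mu\in[0,\infty]}\sigma(F(\mu))=\bigcup_{\mu\in[0,\infty]}\{\zeta(\mu),-\zeta(\mu)\}$; 4. the spectral radii of $\mathcal{M}_F$ and of $\mathscr{F}_{\mathbb{R}^+}$ are both equal to $1/\sqrt2$. -/

import Mathlib

open MeasureTheory Set Filter
open scoped ENNReal FourierTransform

noncomputable section

namespace TruncatedFourier

/-- Lebesgue measure on the positive semiaxis. -/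
abbrev volPlus : Measure ℝ := (volume : Measure ℝ).restrict (Ioi 0)

/-- The Hilbert space `L²(ℝ)` of complex-valued functions. -/
abbrev L2Line : Type := Lp ℂ 2 (volume : Measure ℝ)

/-- The Hilbert space `L²(ℝ⁺)` of complex-valued functions. -/
abbrev L2Plus : Type := Lp ℂ 2 volPlus

/-! ### The Fourier–Plancherel operator on the line -/

theorem map_dilation :
    Measure.map (fun t : ℝ => (2 * Real.pi)⁻¹ * t) volume
      = ENNReal.ofReal (2 * Real.pi) • (volume : Measure ℝ) := by
  have h := Real.map_volume_mul_left (a := (2 * Real.pi)⁻¹) (by positivity)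
  rwa [inv_inv, abs_of_pos (by positivity)] at h

theorem quasi_dilation :
    Measure.QuasiMeasurePreserving (fun t : ℝ => (2 * Real.pi)⁻¹ * t) volume volume := by
  refine ⟨by fun_prop, ?_⟩
  rw [map_dilation]
  exact Measure.smul_absolutelyContinuous

theorem eLpNorm_dilation (g : L2Line) :
    eLpNorm (fun t : ℝ => ((Real.sqrt (2 * Real.pi))⁻¹ : ℂ) * g ((2 * Real.pi)⁻¹ * t)) 2 volume
      = eLpNorm g 2 volume := by
  have hm : AEStronglyMeasurable g
      (Measure.map (fun t : ℝ => (2 * Real.pi)⁻¹ * t) volume) := by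
    rw [map_dilation]
    exact (Lp.aestronglyMeasurable g).smul_measure _
  have h1 := eLpNorm_map_measure (p := 2) hm (by fun_prop)
  rw [map_dilation, eLpNorm_smul_measure_of_ne_top (by simp)] at h1
  have h2 : (fun t : ℝ => ((Real.sqrt (2 * Real.pi))⁻¹ : ℂ) * g ((2 * Real.pi)⁻¹ * t))
      = ((Real.sqrt (2 * Real.pi))⁻¹ : ℂ) • ((g : ℝ → ℂ) ∘ fun t : ℝ => (2 * Real.pi)⁻¹ * t) := by
    ext t; simp
  have hpos : 0 < Real.sqrt (2 * Real.pi) := by positivity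
  rw [h2, eLpNorm_const_smul, ← h1, smul_eq_mul, ← mul_assoc]
  have h3 : ‖((Real.sqrt (2 * Real.pi))⁻¹ : ℂ)‖ₑ = ENNReal.ofReal (Real.sqrt (2 * Real.pi))⁻¹ := by
    rw [← ofReal_norm, norm_inv, Complex.norm_real, Real.norm_of_nonneg hpos.le]
  have h4 : ENNReal.ofReal (2 * Real.pi) ^ (1 / (2 : ℝ≥0∞)).toReal
      = ENNReal.ofReal (Real.sqrt (2 * Real.pi)) := by
    rw [ENNReal.ofReal_rpow_of_pos (by positivity), Real.sqrt_eq_rpow]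
    norm_num
  rw [h3, h4, ← ENNReal.ofReal_mul (by positivity), inv_mul_cancel₀ hpos.ne']
  simp

theorem memLp_dilation (g : L2Line) :
    MemLp (fun t : ℝ => ((Real.sqrt (2 * Real.pi))⁻¹ : ℂ) * g ((2 * Real.pi)⁻¹ * t)) 2 volume := by
  refine ⟨?_, ?_⟩
  · exact ((Lp.aestronglyMeasurable g).comp_quasiMeasurePreserving quasi_dilation).const_mul _
  · rw [eLpNorm_dilation]
    exact Lp.eLpNorm_lt_top g

/-- The unitary dilation `g ↦ (2π)^{-1/2} g(t / 2π)` of `L²(ℝ)`. -/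
def dilation : L2Line →ₗᵢ[ℂ] L2Line where
  toFun g := (memLp_dilation g).toLp _
  map_add' f g := by
    rw [← MemLp.toLp_add, MemLp.toLp_eq_toLp_iff]
    filter_upwards [quasi_dilation.ae (Lp.coeFn_add f g)] with t ht
    simp only [Pi.add_apply] at ht ⊢
    rw [ht, mul_add]
  map_smul' c g := by
    rw [RingHom.id_apply, ← MemLp.toLp_const_smul, MemLp.toLp_eq_toLp_iff]
    filter_upwards [quasi_dilation.ae (Lp.coeFn_smul c g)] with t ht
    simp only [Pi.smul_apply, smul_eq_mul] at ht ⊢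
    rw [ht]
    ring
  norm_map' g := by
    change ‖(memLp_dilation g).toLp _‖ = ‖g‖
    rw [Lp.norm_toLp, eLpNorm_dilation, Lp.norm_def]

/-- The Fourier–Plancherel operator `(ℱx)(t) = (2π)^{-1/2} ∫ x(ξ) e^{itξ} dξ` on `L²(ℝ)`.
Mathlib's `𝓕⁻` on `L²(ℝ)` is `s ↦ ∫ x(ξ) e^{2πisξ} dξ` (extended by continuity), and
`(ℱx)(t) = (2π)^{-1/2} (𝓕⁻x)(t / 2π)`. -/
def fourierPlancherel : L2Line →L[ℂ] L2Line :=
  dilation.toContinuousLinearMap ∘L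
    ((Lp.fourierTransformₗᵢ ℝ ℂ).symm.toContinuousLinearEquiv : L2Line →L[ℂ] L2Line)

/-! ### The truncated operator -/

/-- The inclusion `L²(ℝ⁺) ⊆ L²(ℝ)`: extension of a function by zero. -/
def extendZero : L2Plus →ₗᵢ[ℂ] L2Line where
  toFun x := ((memLp_indicator_iff_restrict measurableSet_Ioi).2 (Lp.memLp x)).toLp
    ((Ioi (0 : ℝ)).indicator x)
  map_add' x y := by
    rw [← MemLp.toLp_add, MemLp.toLp_eq_toLp_iff]
    filter_upwards [(ae_restrict_iff' measurableSet_Ioi).1 (Lp.coeFn_add x y)] with t ht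
    by_cases h : t ∈ Ioi (0 : ℝ)
    · simp only [Pi.add_apply, indicator_of_mem h]
      exact ht h
    · simp only [Pi.add_apply, indicator_of_notMem h, add_zero]
  map_smul' c x := by
    rw [RingHom.id_apply, ← MemLp.toLp_const_smul, MemLp.toLp_eq_toLp_iff]
    filter_upwards [(ae_restrict_iff' measurableSet_Ioi).1 (Lp.coeFn_smul c x)] with t ht
    by_cases h : t ∈ Ioi (0 : ℝ)
    · simp only [Pi.smul_apply, indicator_of_mem h]
      exact ht h
    · simp only [Pi.smul_apply, indicator_of_notMem h, smul_zero]
  norm_map' x := by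
    change ‖((memLp_indicator_iff_restrict measurableSet_Ioi).2 (Lp.memLp x)).toLp
      ((Ioi (0 : ℝ)).indicator x)‖ = ‖x‖
    rw [Lp.norm_toLp, eLpNorm_indicator_eq_eLpNorm_restrict measurableSet_Ioi, Lp.norm_def]

/-- The projector of `L²(ℝ)` onto `L²(ℝ⁺)`: restriction of a function to `ℝ⁺`. -/
def restrictPlus : L2Line →L[ℂ] L2Plus :=
  LpToLpRestrictCLM ℝ ℂ ℂ volume 2 (Ioi 0)

/-- The truncated Fourier operator `ℱ_{ℝ⁺} = P ℱ P|_{L²(ℝ⁺)}`, that is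
`(ℱ_{ℝ⁺} x)(t) = (2π)^{-1/2} ∫_{ℝ⁺} x(ξ) e^{itξ} dξ`, `t ∈ ℝ⁺`. -/
def truncatedFourier : L2Plus →L[ℂ] L2Plus :=
  restrictPlus ∘L fourierPlancherel ∘L extendZero.toContinuousLinearMap

/-! ### The model space and multiplication operators -/

/-- The model space: columns `(φ₊, φ₋)` with entries in `L²(ℝ⁺)`, with the norm
`‖φ‖² = ‖φ₊‖² + ‖φ₋‖²`. The index `0` stands for `+` and `1` for `-`. -/
abbrev ModelSpace : Type := PiLp 2 (fun _ : Fin 2 => L2Plus)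

/-- Multiplication by an essentially bounded scalar function on `L²(ℝ⁺)`. -/
def scalarMul (g : ℝ → ℂ) (hg : MemLp g ∞ volPlus) : L2Plus →L[ℂ] L2Plus :=
  (ContinuousLinearMap.mul ℂ ℂ).holderL volPlus ∞ 2 2 (hg.toLp g)

/-- The multiplication operator `(ℳ_M y)(μ) = M(μ) y(μ)` generated by an essentially bounded
matrix function `M`. -/
def multiplicationOperator (M : ℝ → Matrix (Fin 2) (Fin 2) ℂ)
    (hM : ∀ i j, MemLp (fun μ => M μ i j) ∞ volPlus) : ModelSpace →L[ℂ] ModelSpace :=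
  ((PiLp.continuousLinearEquiv 2 ℂ (fun _ : Fin 2 => L2Plus)).symm :
      (Fin 2 → L2Plus) →L[ℂ] ModelSpace) ∘L
    ContinuousLinearMap.pi fun i =>
      ∑ j, scalarMul (fun μ => M μ i j) (hM i j) ∘L PiLp.proj 2 (fun _ : Fin 2 => L2Plus) j

theorem scalarMul_coeFn (g : ℝ → ℂ) (hg : MemLp g ∞ volPlus) (x : L2Plus) :
    scalarMul g hg x =ᵐ[volPlus] fun μ => g μ * x μ := by
  have h : scalarMul g hg x = (ContinuousLinearMap.mul ℂ ℂ).holder 2 (hg.toLp g) x := rfl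
  rw [h]
  filter_upwards [(ContinuousLinearMap.mul ℂ ℂ).coeFn_holder (r := 2) (hg.toLp g) x,
    hg.coeFn_toLp] with μ h1 h2
  rw [h1, h2]
  rfl

theorem multiplicationOperator_coeFn (M : ℝ → Matrix (Fin 2) (Fin 2) ℂ)
    (hM : ∀ i j, MemLp (fun μ => M μ i j) ∞ volPlus) (y : ModelSpace) (i : Fin 2) :
    (multiplicationOperator M hM y) i =ᵐ[volPlus]
      fun μ => (M μ).mulVec (fun j => y j μ) i := by
  have h : (multiplicationOperator M hM y) i
      = scalarMul (fun μ => M μ i 0) (hM i 0) (y 0)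
        + scalarMul (fun μ => M μ i 1) (hM i 1) (y 1) := by
    simp [multiplicationOperator, Fin.sum_univ_two]
  rw [h]
  filter_upwards [Lp.coeFn_add (scalarMul (fun μ => M μ i 0) (hM i 0) (y 0))
      (scalarMul (fun μ => M μ i 1) (hM i 1) (y 1)),
    scalarMul_coeFn _ (hM i 0) (y 0), scalarMul_coeFn _ (hM i 1) (y 1)] with μ h1 h2 h3
  rw [h1, Pi.add_apply, h2, h3]
  simp [Matrix.mulVec, dotProduct, Fin.sum_univ_two]

/-! ### The model operator -/

/-- `F₊₋(μ) = (2π)^{-1/2} e^{iπ/4} e^{-πμ/2} Γ(1/2 + iμ)`. -/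
def Fpm (μ : ℝ) : ℂ :=
  ((Real.sqrt (2 * Real.pi))⁻¹ : ℂ) * Complex.exp (Complex.I * Real.pi / 4) *
    Real.exp (-(Real.pi / 2) * μ) * Complex.Gamma (1 / 2 + Complex.I * μ)

/-- `F₋₊(μ) = (2π)^{-1/2} e^{iπ/4} e^{πμ/2} Γ(1/2 - iμ)`. -/
def Fmp (μ : ℝ) : ℂ :=
  ((Real.sqrt (2 * Real.pi))⁻¹ : ℂ) * Complex.exp (Complex.I * Real.pi / 4) *
    Real.exp (Real.pi / 2 * μ) * Complex.Gamma (1 / 2 - Complex.I * μ)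

/-- The matrix function `F(μ)`. -/
def F (μ : ℝ) : Matrix (Fin 2) (Fin 2) ℂ :=
  !![0, Fpm μ; Fmp μ, 0]

theorem Fmp_eq (μ : ℝ) : Fmp μ = Fpm (-μ) := by
  simp [Fmp, Fpm, sub_eq_add_neg]

theorem continuous_Fpm : Continuous Fpm := by
  have h : Continuous fun μ : ℝ => Complex.Gamma (1 / 2 + Complex.I * μ) := by
    rw [continuous_iff_continuousAt]
    intro μ
    have hd : DifferentiableAt ℂ Complex.Gamma (1 / 2 + Complex.I * μ) := by
      apply Complex.differentiableAt_Gamma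
      intro m hm
      have := congrArg Complex.re hm
      simp at this
      have hm0 : (0 : ℝ) ≤ m := m.cast_nonneg
      linarith
    exact ContinuousAt.comp (f := fun μ : ℝ => (1 / 2 + Complex.I * μ : ℂ)) hd.continuousAt
      (by fun_prop)
  unfold Fpm
  fun_prop

theorem norm_Gamma_half_sq (μ : ℝ) :
    ‖Complex.Gamma (1 / 2 + Complex.I * μ)‖ ^ 2 = Real.pi / Real.cosh (Real.pi * μ) := by
  have h1 : (1 : ℂ) - (1 / 2 + Complex.I * μ) = (starRingEnd ℂ) (1 / 2 + Complex.I * μ) := by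
    apply Complex.ext <;> simp
    norm_num
  have h2 := Complex.Gamma_mul_Gamma_one_sub (1 / 2 + Complex.I * μ)
  rw [h1, Complex.Gamma_conj, Complex.mul_conj, Complex.normSq_eq_norm_sq] at h2
  have h3 : Complex.sin (Real.pi * (1 / 2 + Complex.I * μ)) = (Real.cosh (Real.pi * μ) : ℝ) := by
    have : (Real.pi * (1 / 2 + Complex.I * μ) : ℂ)
        = (Real.pi * μ : ℂ) * Complex.I + Real.pi / 2 := by ring
    rw [this, Complex.sin_add_pi_div_two, Complex.cos_mul_I]
    push_cast
    rfl
  rw [h3] at h2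
  exact_mod_cast h2

theorem norm_Fpm_le (μ : ℝ) : ‖Fpm μ‖ ≤ 1 := by
  have hpi := Real.pi_pos
  have hs : Real.sqrt (2 * Real.pi) ^ 2 = 2 * Real.pi := Real.sq_sqrt (by positivity)
  have he : ‖Complex.exp (Complex.I * Real.pi / 4)‖ = 1 := by
    rw [Complex.norm_exp]
    simp
  have hn : ‖Fpm μ‖ ^ 2 = (2 * Real.pi)⁻¹ * Real.exp (-(Real.pi * μ)) *
      (Real.pi / Real.cosh (Real.pi * μ)) := by
    have hx : Real.exp (-(Real.pi / 2) * μ) ^ 2 = Real.exp (-(Real.pi * μ)) := by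
      rw [← Real.exp_nat_mul]
      congr 1
      push_cast
      ring
    rw [Fpm, norm_mul, norm_mul, norm_mul, he, norm_inv, Complex.norm_real, Complex.norm_real,
      Real.norm_of_nonneg (Real.sqrt_nonneg _), Real.norm_of_nonneg (Real.exp_pos _).le,
      mul_pow, mul_pow, mul_pow, inv_pow, hs, hx, norm_Gamma_half_sq, one_pow, mul_one]
  have hc := Real.cosh_pos (Real.pi * μ)
  have hle : ‖Fpm μ‖ ^ 2 ≤ 1 := by
    rw [hn]
    have : (2 * Real.pi)⁻¹ * Real.exp (-(Real.pi * μ)) * (Real.pi / Real.cosh (Real.pi * μ))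
        = Real.exp (-(Real.pi * μ)) / (2 * Real.cosh (Real.pi * μ)) := by
      field_simp
    rw [this, div_le_one (by positivity), Real.cosh_eq]
    have := Real.exp_pos (Real.pi * μ)
    linarith
  nlinarith [norm_nonneg (Fpm μ)]

theorem memLp_F (i j : Fin 2) : MemLp (fun μ => F μ i j) ∞ volPlus := by
  have h1 : MemLp Fpm ∞ volPlus :=
    memLp_top_of_bound continuous_Fpm.aestronglyMeasurable 1 (Eventually.of_forall norm_Fpm_le)
  have h2 : MemLp Fmp ∞ volPlus := by
    have hc : Continuous Fmp := by
      rw [funext Fmp_eq]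
      exact continuous_Fpm.comp continuous_neg
    refine memLp_top_of_bound hc.aestronglyMeasurable 1 (Eventually.of_forall fun μ => ?_)
    rw [Fmp_eq]
    exact norm_Fpm_le _
  fin_cases i <;> fin_cases j
  · simp [F]
  · simpa [F] using h1
  · simpa [F] using h2
  · simp [F]

/-- The model operator `ℳ_F`. -/
def modelOperator : ModelSpace →L[ℂ] ModelSpace := multiplicationOperator F memLp_F

/-! ### Eigenvalues, also at `μ = ∞` -/

/-- `ζ(μ) = e^{iπ/4} (2 cosh πμ)^{-1/2}` for `μ ∈ [0, ∞)`, and `ζ(∞) = lim ζ(μ) = 0`. -/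
def zeta (μ : ℝ≥0∞) : ℂ :=
  if μ = ∞ then 0
  else Complex.exp (Complex.I * Real.pi / 4) *
    ((1 / Real.sqrt (2 * Real.cosh (Real.pi * μ.toReal)) : ℝ) : ℂ)

/-- The family `F(μ)` for `μ ∈ [0, ∞]`. As `μ → ∞` one has `F₊₋(μ) → 0` and `|F₋₊(μ)| → 1`,
while the argument of `F₋₊(μ)` does not converge; `F(∞)` is the limit of the entrywise
moduli, a Jordan cell. -/
def Fext (μ : ℝ≥0∞) : Matrix (Fin 2) (Fin 2) ℂ :=
  if μ = ∞ then !![0, 0; 1, 0] else F μ.toReal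

/-- The endpoint `e^{iπ/4} / √2`. -/
def endpoint : ℂ := Complex.exp (Complex.I * Real.pi / 4) * ((1 / Real.sqrt 2 : ℝ) : ℂ)

end TruncatedFourier

end

/-! Both operators are handled by one scheme, based on the square and not on a unitary equivalence
between them. Let `A` be either operator. The form `⟨x, A²x⟩` is `i` times a number in `[0,
‖x‖²/2]`, so `-iA²` is self-adjoint and lies between `0` and `1/2`. Spectral mapping then puts `z²`
in `i[0, 1/2]` for every `z` in the spectrum, which confines `z` to the segment.

Conversely, `A²` has approximate eigenvectors `x` at every `ζ(μ)² = i / (2 cosh πμ)`. To obtain both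
square roots `±ζ(μ)`, and not merely one of them, `x` is also chosen with `⟨x, Ax⟩` negligible
against `‖x‖²` (`mem_spectrum_of_approx`). The values `±ζ(μ)` with `μ` finite fill the segment
except for `0`, which is recovered by closedness (`spectrum_eq_segment`).

For the model operator, `A²` is multiplication by the scalar `F₊₋F₋₊ = i / (2 cosh πμ)`, by the
reflection formula for Gamma. A narrow bump in one component is an approximate eigenvector of `A²`,
and it is orthogonal to its image because `F` is antidiagonal.

For the truncated Fourier operator, `∫₀^∞ e^{it(ξ+η)} dt = i/(ξ+η)`, read as an Abel limit, shows
that `A²` is `i/(2π)` times the Carleman operator with kernel `1/(ξ+η)`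
(`pairing_truncatedFourier_sq`). That operator is positive, since `1/(ξ+η) = ∫₀^∞ e^{-tξ} e^{-tη}
dt`, and its form is at most `π‖x‖²` by the Schur test. The powers `ξ^{s-1}` are generalized
eigenfunctions with eigenvalue `Γ(s)Γ(1-s)`, equal to `π / cosh πμ` at `s = 1/2 + iμ`. Cutting them
off to `(0,1)` with `Re s` slightly above `1/2` makes the `L²` norm blow up, while the error and
`⟨x, Ax⟩` stay bounded (`truncatedFourier_approx`). -/

noncomputable section

namespace TruncatedFourier

/-! ### Spectral lemmas -/

section Abstract

variable {E : Type*} [NormedAddCommGroup E] [InnerProductSpace ℂ E]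

/-- If `x` is an approximate eigenvector of `A²` at `z²` and is almost orthogonal to `A x`, then `z`
belongs to the spectrum of `A`. -/
theorem mem_spectrum_of_approx (A : E →L[ℂ] E) {z : ℂ} (hz : z ≠ 0)
    (h : ∀ ε > 0, ∃ x : E, x ≠ 0 ∧ ‖A (A x) - z ^ 2 • x‖ ≤ ε * ‖x‖ ∧
      ‖inner ℂ x (A x)‖ ≤ ε * ‖x‖ ^ 2) : z ∈ spectrum ℂ A := by
  by_contra hn
  rw [spectrum.notMem_iff] at hn
  obtain ⟨u, hu⟩ := hn
  set R : E →L[ℂ] E := ((u⁻¹ : (E →L[ℂ] E)ˣ) : E →L[ℂ] E) with hR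
  have hRu : ∀ v, R (z • v - A v) = v := by
    intro v
    have h1 : R * (u : E →L[ℂ] E) = 1 := by rw [hR]; exact u.inv_mul
    have h2 := congrArg (fun T : E →L[ℂ] E => T v) h1
    rw [hu] at h2
    simpa [Algebra.algebraMap_eq_smul_one] using h2
  have hzp : 0 < ‖z‖ := norm_pos_iff.2 hz
  have hRp : 0 < 1 + ‖R‖ := by positivity
  -- With this tolerance the two errors add up to at most `(1 + ‖R‖) ε = ‖z‖/2` times `‖x‖²`, too
  -- little to account for `⟨x, zx⟩`.
  obtain ⟨x, hx, h1, h2⟩ := h (‖z‖ / (2 * (1 + ‖R‖))) (by positivity)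
  set ε := ‖z‖ / (2 * (1 + ‖R‖)) with hε
  have hxp : 0 < ‖x‖ := norm_pos_iff.2 hx
  have hv : ‖A x + z • x‖ ≤ ‖R‖ * (ε * ‖x‖) := by
    have h3 := hRu (A x + z • x)
    -- The factorization `(z - A)(A + z) = -(A² - z²)`: a bounded resolvent forces `Ax ≈ -zx`.
    have h4 : z • (A x + z • x) - A (A x + z • x) = -(A (A x) - z ^ 2 • x) := by
      rw [map_add, map_smul, smul_add, smul_smul, pow_two]
      abel
    rw [h4] at h3
    calc ‖A x + z • x‖ = ‖R (-(A (A x) - z ^ 2 • x))‖ := by rw [h3]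
      _ ≤ ‖R‖ * ‖-(A (A x) - z ^ 2 • x)‖ := R.le_opNorm _
      _ ≤ _ := by
        rw [norm_neg]
        gcongr
  have h5 : ‖z‖ * ‖x‖ ^ 2 ≤ ‖x‖ * ‖A x + z • x‖ + ε * ‖x‖ ^ 2 := by
    have h6 : inner ℂ x (z • x) = inner ℂ x (A x + z • x) - inner ℂ x (A x) := by
      rw [inner_add_right]; ring
    have h7 : ‖inner ℂ x (z • x)‖ = ‖z‖ * ‖x‖ ^ 2 := by
      rw [inner_smul_right, norm_mul, inner_self_eq_norm_sq_to_K]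
      simp
    rw [← h7, h6]
    exact (norm_sub_le _ _).trans (add_le_add (norm_inner_le_norm _ _) h2)
  have h8 : ‖z‖ * ‖x‖ ^ 2 ≤ ((1 + ‖R‖) * ε) * ‖x‖ ^ 2 := by
    nlinarith [mul_le_mul_of_nonneg_left hv hxp.le]
  have h9 : (1 + ‖R‖) * ε = ‖z‖ / 2 := by
    rw [hε]; field_simp
  rw [h9] at h8
  have : 0 < ‖z‖ * ‖x‖ ^ 2 := by positivity
  linarith

/-- On a complex Hilbert space a real quadratic form makes `S = -iA²` self-adjoint, and the bounds
on the form make `S` and `1/2 - S` positive, so the spectrum of `S` lies in `[0, 1/2]`. Spectral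
mapping transfers this to `z²`. -/
theorem sq_eq_I_mul_of_mem_spectrum [CompleteSpace E] (A : E →L[ℂ] E)
    (h : ∀ x : E, ∃ r : ℝ, 0 ≤ r ∧ r ≤ ‖x‖ ^ 2 / 2 ∧ inner ℂ x (A (A x)) = Complex.I * r)
    {z : ℂ} (hz : z ∈ spectrum ℂ A) :
    ∃ r : ℝ, 0 ≤ r ∧ r ≤ 1 / 2 ∧ z ^ 2 = Complex.I * r := by
  set S : E →L[ℂ] E := (-Complex.I) • A ^ 2 with hS
  have hin : ∀ x, ∃ r : ℝ, 0 ≤ r ∧ r ≤ ‖x‖ ^ 2 / 2 ∧ inner ℂ x (S x) = (r : ℂ) := by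
    intro x
    obtain ⟨r, h0, h1, h2⟩ := h x
    refine ⟨r, h0, h1, ?_⟩
    have : S x = (-Complex.I) • A (A x) := by simp [hS, pow_two]
    rw [this, inner_smul_right, h2, ← mul_assoc]
    simp
  have hpos : S.IsPositive := by
    rw [ContinuousLinearMap.isPositive_iff_complex]
    intro x
    obtain ⟨r, h0, h1, h2⟩ := hin x
    rw [← inner_conj_symm, h2]
    simp [h0]
  have hpos' : ((1 / 2 : ℂ) • (1 : E →L[ℂ] E) - S).IsPositive := by
    rw [ContinuousLinearMap.isPositive_iff_complex]
    intro x
    obtain ⟨r, h0, h1, h2⟩ := hin x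
    have h3 : inner ℂ x (((1 / 2 : ℂ) • (1 : E →L[ℂ] E) - S) x)
        = ((‖x‖ ^ 2 / 2 - r : ℝ) : ℂ) := by
      have : ((1 / 2 : ℂ) • (1 : E →L[ℂ] E) - S) x = (1 / 2 : ℂ) • x - S x := by simp
      rw [this, inner_sub_right, inner_smul_right, h2, inner_self_eq_norm_sq_to_K]
      push_cast
      simp
      ring
    rw [← inner_conj_symm, h3, Complex.conj_ofReal]
    exact ⟨by simp only [RCLike.re_to_complex, Complex.ofReal_re],
      by rw [RCLike.re_to_complex, Complex.ofReal_re]; linarith⟩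
  set w : ℂ := -Complex.I * z ^ 2 with hw
  have hwS : w ∈ spectrum ℂ S := by
    have h1 : z ^ 2 ∈ spectrum ℂ (A ^ 2) := spectrum.pow_mem_pow A 2 hz
    exact (spectrum.smul_mem_smul_iff
      (r := (Units.mk0 (-Complex.I) (by simp) : ℂˣ))).2 h1
  -- The upper bound on `w` is nonnegativity of the spectrum of `1/2 - S`.
  have hwS' : (1 / 2 : ℂ) - w ∈ spectrum ℂ ((1 / 2 : ℂ) • (1 : E →L[ℂ] E) - S) := by
    rw [← Algebra.algebraMap_eq_smul_one, ← spectrum.singleton_sub_eq]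
    exact Set.sub_mem_sub rfl hwS
  have key : ∀ (T : E →L[ℂ] E), T.IsPositive → ∀ v ∈ spectrum ℂ T, 0 ≤ v.re ∧ v = (v.re : ℂ) := by
    intro T hT v hv
    have h1 : v = (v.re : ℂ) := hT.isSelfAdjoint.mem_spectrum_eq_re hv
    refine ⟨?_, h1⟩
    rw [h1] at hv
    exact spectrum_nonneg_of_nonneg ((ContinuousLinearMap.nonneg_iff_isPositive T).2 hT)
      ((spectrum.algebraMap_mem_iff ℂ).1 hv)
  obtain ⟨h1, h2⟩ := key S hpos w hwS
  obtain ⟨h3, -⟩ := key _ hpos' _ hwS'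
  refine ⟨w.re, h1, ?_, ?_⟩
  · simpa using h3
  · rw [← h2, hw, ← mul_assoc]
    simp

end Abstract

/-! ### The segment -/

theorem exp_quarter_sq : Complex.exp (Complex.I * Real.pi / 4) ^ 2 = Complex.I := by
  rw [← Complex.exp_nat_mul]
  have : ((2 : ℕ) : ℂ) * (Complex.I * Real.pi / 4) = Real.pi / 2 * Complex.I := by
    push_cast; ring
  rw [this, Complex.exp_pi_div_two_mul_I]

theorem norm_exp_quarter : ‖Complex.exp (Complex.I * Real.pi / 4)‖ = 1 := by
  rw [Complex.norm_exp]
  simp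

theorem mem_segment_endpoint_iff {z : ℂ} : z ∈ segment ℝ (-endpoint) endpoint ↔
    ∃ s : ℝ, |s| ≤ 1 / Real.sqrt 2 ∧ z = Complex.exp (Complex.I * Real.pi / 4) * s := by
  have h2 : 0 < Real.sqrt 2 := by positivity
  rw [segment_eq_image]
  constructor
  · rintro ⟨θ, ⟨h0, h1⟩, rfl⟩
    refine ⟨(2 * θ - 1) * (1 / Real.sqrt 2), ?_, ?_⟩
    · rw [abs_mul, abs_of_pos (by positivity : 0 < 1 / Real.sqrt 2)]
      refine mul_le_of_le_one_left (by positivity) ?_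
      rw [abs_le]
      constructor <;> linarith
    · simp only [endpoint, Complex.real_smul]
      push_cast
      ring
  · rintro ⟨s, hs, rfl⟩
    obtain ⟨ha, hb⟩ := abs_le.1 hs
    have hs' : s = (Real.sqrt 2 * s) * (1 / Real.sqrt 2) := by field_simp
    have h3 : Real.sqrt 2 * (1 / Real.sqrt 2) = 1 := by field_simp
    refine ⟨(Real.sqrt 2 * s + 1) / 2, ⟨?_, ?_⟩, ?_⟩
    · nlinarith
    · nlinarith
    · conv_rhs => rw [hs']
      simp only [endpoint, Complex.real_smul]
      push_cast
      ring

theorem mem_segment_endpoint_of_sq {z : ℂ} {r : ℝ} (h0 : 0 ≤ r) (h1 : r ≤ 1 / 2)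
    (hz : z ^ 2 = Complex.I * r) : z ∈ segment ℝ (-endpoint) endpoint := by
  rw [mem_segment_endpoint_iff]
  have hr : Real.sqrt r ≤ 1 / Real.sqrt 2 := by
    rw [← Real.sqrt_one, ← Real.sqrt_div zero_le_one]
    exact Real.sqrt_le_sqrt h1
  have h2 : z ^ 2 = (Complex.exp (Complex.I * Real.pi / 4) * (Real.sqrt r : ℝ)) ^ 2 := by
    rw [mul_pow, exp_quarter_sq, hz, ← Complex.ofReal_pow, Real.sq_sqrt h0]
  rcases sq_eq_sq_iff_eq_or_eq_neg.1 h2 with h | h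
  · exact ⟨Real.sqrt r, by rwa [abs_of_nonneg (Real.sqrt_nonneg r)], h⟩
  · exact ⟨-Real.sqrt r, by rwa [abs_neg, abs_of_nonneg (Real.sqrt_nonneg r)], by rw [h]; simp⟩

theorem zeta_top : zeta ∞ = 0 := by simp [zeta]

theorem zeta_sq {μ : ℝ≥0∞} (hμ : μ ≠ ∞) :
    zeta μ ^ 2 = Complex.I / (2 * Real.cosh (Real.pi * μ.toReal) : ℝ) := by
  have hc := Real.cosh_pos (Real.pi * μ.toReal)
  rw [zeta, if_neg hμ, mul_pow, exp_quarter_sq, ← Complex.ofReal_pow, div_pow,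
    Real.sq_sqrt (by positivity)]
  push_cast
  ring

theorem exists_cosh_eq {c : ℝ} (hc : 1 ≤ c) : ∃ v : ℝ, 0 ≤ v ∧ Real.cosh v = c := by
  -- The endpoint `2c` suffices because `cosh 2c ≥ e^{2c}/2 ≥ (2c + 1)/2`.
  have h1 := intermediate_value_Icc (f := Real.cosh) (a := 0) (b := 2 * c) (by linarith)
    Real.continuous_cosh.continuousOn
  have h2 : c ≤ Real.cosh (2 * c) := by
    rw [Real.cosh_eq]
    have := Real.add_one_le_exp (2 * c)
    have := Real.exp_pos (-(2 * c))
    linarith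
  obtain ⟨v, hv, h⟩ := h1 ⟨by simpa using hc, h2⟩
  exact ⟨v, hv.1, h⟩

/-- A point `e^{iπ/4} s` with `s ≠ 0` has square `i s²`, so it is `±ζ(μ)` once `cosh πμ = 1/(2s²)`,
which is solvable exactly because `s² ≤ 1/2`. The point `0` comes from `μ = ∞`. -/
theorem segment_endpoint_eq_iUnion_zeta :
    segment ℝ (-endpoint) endpoint = ⋃ μ : ℝ≥0∞, {zeta μ, -zeta μ} := by
  ext z
  simp only [mem_iUnion, mem_insert_iff, mem_singleton_iff]
  constructor
  · rw [mem_segment_endpoint_iff]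
    rintro ⟨s, hs, rfl⟩
    rcases eq_or_ne s 0 with rfl | hs0
    · exact ⟨∞, by simp [zeta_top]⟩
    have hsp : 0 < s ^ 2 := by positivity
    have hs2 : s ^ 2 ≤ 1 / 2 := by
      have : |s| ^ 2 ≤ (1 / Real.sqrt 2) ^ 2 := by gcongr
      rwa [sq_abs, div_pow, Real.sq_sqrt zero_le_two, one_pow] at this
    obtain ⟨v, hv, hcv⟩ := exists_cosh_eq (c := 1 / (2 * s ^ 2))
      (by rw [le_div_iff₀ (by positivity)]; linarith)
    refine ⟨ENNReal.ofReal (v / Real.pi), ?_⟩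
    rw [← sq_eq_sq_iff_eq_or_eq_neg, zeta_sq ENNReal.ofReal_ne_top,
      ENNReal.toReal_ofReal (by positivity), mul_div_cancel₀ _ Real.pi_ne_zero, hcv, mul_pow,
      exp_quarter_sq]
    have : 2 * (1 / (2 * s ^ 2)) = (s ^ 2)⁻¹ := by field_simp
    rw [this]
    push_cast
    field_simp
  · rintro ⟨μ, h⟩
    rcases eq_or_ne μ ∞ with rfl | hμ
    · rw [zeta_top, neg_zero, or_self] at h
      exact mem_segment_endpoint_of_sq le_rfl (by norm_num) (by simp [h])
    · have h1 := sq_eq_sq_iff_eq_or_eq_neg.2 h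
      rw [zeta_sq hμ] at h1
      have hc := Real.one_le_cosh (Real.pi * μ.toReal)
      refine mem_segment_endpoint_of_sq (r := 1 / (2 * Real.cosh (Real.pi * μ.toReal)))
        (by positivity) ?_ ?_
      · rw [div_le_div_iff₀ (by positivity) (by positivity)]
        linarith
      · rw [h1]
        push_cast
        ring

/-- The common scheme: `hup` confines the spectrum, while `hlow` produces every nonzero point of the
segment. -/
theorem spectrum_eq_segment {E : Type*} [NormedAddCommGroup E] [InnerProductSpace ℂ E]
    [CompleteSpace E] (A : E →L[ℂ] E)
    (hup : ∀ x : E, ∃ r : ℝ, 0 ≤ r ∧ r ≤ ‖x‖ ^ 2 / 2 ∧ inner ℂ x (A (A x)) = Complex.I * r)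
    (hlow : ∀ μ : ℝ, 0 ≤ μ → ∀ ε > 0, ∃ x : E, x ≠ 0 ∧
      ‖A (A x) - (Complex.I / (2 * Real.cosh (Real.pi * μ) : ℝ)) • x‖ ≤ ε * ‖x‖ ∧
      ‖inner ℂ x (A x)‖ ≤ ε * ‖x‖ ^ 2) :
    spectrum ℂ A = segment ℝ (-endpoint) endpoint := by
  apply Subset.antisymm
  · intro z hz
    obtain ⟨r, h0, h1, h2⟩ := sq_eq_I_mul_of_mem_spectrum A hup hz
    exact mem_segment_endpoint_of_sq h0 h1 h2
  · have hne : ∀ z ∈ segment ℝ (-endpoint) endpoint, z ≠ 0 → z ∈ spectrum ℂ A := by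
      intro z hz hz0
      rw [segment_endpoint_eq_iUnion_zeta] at hz
      simp only [mem_iUnion, mem_insert_iff, mem_singleton_iff] at hz
      obtain ⟨μ, h⟩ := hz
      have hμ : μ ≠ ∞ := by
        rintro rfl
        rw [zeta_top, neg_zero, or_self] at h
        exact hz0 h
      refine mem_spectrum_of_approx A hz0 ?_
      rw [sq_eq_sq_iff_eq_or_eq_neg.2 h, zeta_sq hμ]
      exact hlow _ ENNReal.toReal_nonneg
    intro z hz
    rcases eq_or_ne z 0 with rfl | hz0
    · have hcl : IsClosed (spectrum ℂ A) := spectrum.isClosed A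
      -- The point `0` is not reached by `hlow`; it is a limit of spectral points. The shift by `2`
      -- keeps `1/(n + 2)` below `1/√2` from `n = 0` on.
      have hlim : Tendsto (fun n : ℕ => Complex.exp (Complex.I * Real.pi / 4) *
          ((1 / ((n : ℝ) + 2) : ℝ) : ℂ)) atTop (nhds 0) := by
        have h1 : Tendsto (fun n : ℕ => (1 / ((n : ℝ) + 2) : ℝ)) atTop (nhds 0) := by
          simp only [one_div]
          exact tendsto_inv_atTop_zero.comp
            (tendsto_atTop_add_const_right _ _ tendsto_natCast_atTop_atTop)
        have h2 := ((Complex.continuous_ofReal.tendsto 0).comp h1).const_mul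
          (Complex.exp (Complex.I * Real.pi / 4))
        simpa using h2
      refine hcl.mem_of_tendsto hlim (Eventually.of_forall fun n => ?_)
      have hp : (0 : ℝ) < (n : ℝ) + 2 := by positivity
      apply hne
      · rw [mem_segment_endpoint_iff]
        refine ⟨_, ?_, rfl⟩
        rw [abs_of_pos (by positivity)]
        gcongr
        calc Real.sqrt 2 ≤ 2 := by
              rw [Real.sqrt_le_left (by norm_num)]; norm_num
          _ ≤ _ := by linarith [(n.cast_nonneg : (0 : ℝ) ≤ n)]
      · exact mul_ne_zero (Complex.exp_ne_zero _)
          (Complex.ofReal_ne_zero.2 (by positivity))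
    · exact hne z hz hz0

theorem spectralRadius_of_spectrum_eq_segment {E : Type*} [NormedAddCommGroup E]
    [InnerProductSpace ℂ E] (A : E →L[ℂ] E)
    (h : spectrum ℂ A = segment ℝ (-endpoint) endpoint) :
    spectralRadius ℂ A = ENNReal.ofReal (1 / Real.sqrt 2) := by
  have hn : ∀ z : ℂ, (‖z‖₊ : ℝ≥0∞) = ENNReal.ofReal ‖z‖ := fun z => by
    rw [ofReal_norm]; rfl
  rw [spectralRadius, h]
  apply le_antisymm
  · refine iSup₂_le fun z hz => ?_
    obtain ⟨s, hs, rfl⟩ := mem_segment_endpoint_iff.1 hz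
    rw [hn, norm_mul, norm_exp_quarter, one_mul, Complex.norm_real, Real.norm_eq_abs]
    exact ENNReal.ofReal_le_ofReal hs
  · refine le_iSup₂_of_le endpoint (right_mem_segment _ _ _) ?_
    rw [hn, endpoint, norm_mul, norm_exp_quarter, one_mul, Complex.norm_real,
      Real.norm_of_nonneg (by positivity)]

/-! ### The model operator -/

/-- The real exponentials cancel, the two phases multiply to `i`, and the Gamma values are complex
conjugates whose product is `π / cosh πμ`. -/
theorem Fpm_mul_Fmp (μ : ℝ) :
    Fpm μ * Fmp μ = Complex.I / (2 * Real.cosh (Real.pi * μ) : ℝ) := by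
  have hg : Complex.Gamma (1 / 2 + Complex.I * μ) * Complex.Gamma (1 / 2 - Complex.I * μ)
      = (Real.pi / Real.cosh (Real.pi * μ) : ℝ) := by
    have hconj : (1 / 2 - Complex.I * μ : ℂ) = (starRingEnd ℂ) (1 / 2 + Complex.I * μ) := by
      apply Complex.ext <;> simp
    rw [hconj, Complex.Gamma_conj, Complex.mul_conj, Complex.normSq_eq_norm_sq,
      norm_Gamma_half_sq]
  have he : (Real.exp (-(Real.pi / 2) * μ) : ℂ) * Real.exp (Real.pi / 2 * μ) = 1 := by
    rw [← Complex.ofReal_mul, ← Real.exp_add]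
    simp
  have hs : ((Real.sqrt (2 * Real.pi) : ℂ)) ^ 2 = 2 * Real.pi := by
    rw [← Complex.ofReal_pow, Real.sq_sqrt (by positivity)]
    push_cast
    rfl
  have hc : (Real.cosh (Real.pi * μ) : ℂ) ≠ 0 :=
    Complex.ofReal_ne_zero.2 (Real.cosh_pos _).ne'
  have hp : (Real.pi : ℂ) ≠ 0 := Complex.ofReal_ne_zero.2 Real.pi_ne_zero
  calc Fpm μ * Fmp μ = ((Real.sqrt (2 * Real.pi) : ℂ) ^ 2)⁻¹ *
        Complex.exp (Complex.I * Real.pi / 4) ^ 2 *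
        ((Real.exp (-(Real.pi / 2) * μ) : ℂ) * Real.exp (Real.pi / 2 * μ)) *
        (Complex.Gamma (1 / 2 + Complex.I * μ) * Complex.Gamma (1 / 2 - Complex.I * μ)) := by
        rw [Fpm, Fmp]; ring
    _ = _ := by
        rw [hs, exp_quarter_sq, he, hg]
        simp only [Complex.ofReal_div, Complex.ofReal_mul, Complex.ofReal_ofNat]
        field_simp

theorem modelOperator_zero_coeFn (y : ModelSpace) :
    (modelOperator y) 0 =ᵐ[volPlus] fun μ => Fpm μ * y 1 μ := by
  filter_upwards [multiplicationOperator_coeFn F memLp_F y 0] with μ h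
  rw [modelOperator, h]
  simp [F, Matrix.mulVec, dotProduct, Fin.sum_univ_two]

theorem modelOperator_one_coeFn (y : ModelSpace) :
    (modelOperator y) 1 =ᵐ[volPlus] fun μ => Fmp μ * y 0 μ := by
  filter_upwards [multiplicationOperator_coeFn F memLp_F y 1] with μ h
  rw [modelOperator, h]
  simp [F, Matrix.mulVec, dotProduct, Fin.sum_univ_two]

theorem modelOperator_sq_coeFn (y : ModelSpace) (i : Fin 2) :
    (modelOperator (modelOperator y)) i =ᵐ[volPlus]
      fun μ => Complex.I / (2 * Real.cosh (Real.pi * μ) : ℝ) * y i μ := by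
  fin_cases i
  · filter_upwards [modelOperator_zero_coeFn (modelOperator y), modelOperator_one_coeFn y]
      with μ h1 h2
    simp only [Fin.zero_eta]
    rw [h1, h2, ← mul_assoc, Fpm_mul_Fmp]
  · filter_upwards [modelOperator_one_coeFn (modelOperator y), modelOperator_zero_coeFn y]
      with μ h1 h2
    simp only [Fin.mk_one]
    rw [h1, h2, ← mul_assoc, mul_comm (Fmp μ), Fpm_mul_Fmp]

theorem norm_sq_eq_integral (x : L2Plus) : ‖x‖ ^ 2 = ∫ t, ‖x t‖ ^ 2 ∂volPlus := by
  have h := L2.inner_def (𝕜 := ℂ) x x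
  rw [inner_self_eq_norm_sq_to_K] at h
  have h2 : ∀ t, inner ℂ (x t) (x t) = ((‖x t‖ ^ 2 : ℝ) : ℂ) := fun t => by
    rw [inner_self_eq_norm_sq_to_K]; simp
  simp only [h2, integral_complex_ofReal] at h
  exact Complex.ofReal_injective (by simpa using h)

theorem integrable_norm_sq (x : L2Plus) : Integrable (fun t => ‖x t‖ ^ 2) volPlus :=
  (memLp_two_iff_integrable_sq_norm (Lp.aestronglyMeasurable x)).1 (Lp.memLp x)

/-- The square acts on each component as the scalar multiplier `i / (2 cosh πμ)`, and `cosh ≥ 1`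
gives the bound `1/2`. -/
theorem modelOperator_sq_form (y : ModelSpace) : ∃ r : ℝ, 0 ≤ r ∧ r ≤ ‖y‖ ^ 2 / 2 ∧
    inner ℂ y (modelOperator (modelOperator y)) = Complex.I * r := by
  have hk : ∀ i : Fin 2, inner ℂ (y i) ((modelOperator (modelOperator y)) i)
      = Complex.I *
        ((∫ μ, (1 / (2 * Real.cosh (Real.pi * μ))) * ‖y i μ‖ ^ 2 ∂volPlus : ℝ) : ℂ) := by
    intro i
    rw [L2.inner_def, ← integral_complex_ofReal, ← integral_const_mul]
    refine integral_congr_ae ?_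
    filter_upwards [modelOperator_sq_coeFn y i] with μ h
    rw [h, ← smul_eq_mul (a := Complex.I / _), inner_smul_right, inner_self_eq_norm_sq_to_K]
    simp only [Complex.coe_algebraMap]
    push_cast
    ring
  have hb : ∀ i : Fin 2, 0 ≤ ∫ μ, (1 / (2 * Real.cosh (Real.pi * μ))) * ‖y i μ‖ ^ 2 ∂volPlus ∧
      ∫ μ, (1 / (2 * Real.cosh (Real.pi * μ))) * ‖y i μ‖ ^ 2 ∂volPlus ≤ ‖y i‖ ^ 2 / 2 := by
    intro i
    have h0 : ∀ μ, 0 ≤ (1 / (2 * Real.cosh (Real.pi * μ))) * ‖y i μ‖ ^ 2 := fun μ => by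
      have := Real.cosh_pos (Real.pi * μ)
      positivity
    refine ⟨integral_nonneg h0, ?_⟩
    rw [norm_sq_eq_integral, ← integral_div]
    refine integral_mono_of_nonneg (Eventually.of_forall h0)
      ((integrable_norm_sq (y i)).div_const 2) (Eventually.of_forall fun μ => ?_)
    have := Real.one_le_cosh (Real.pi * μ)
    have h1 : 1 / (2 * Real.cosh (Real.pi * μ)) ≤ 1 / 2 := by
      rw [div_le_div_iff₀ (by positivity) (by positivity)]
      linarith
    have := mul_le_mul_of_nonneg_right h1 (sq_nonneg ‖y i μ‖)
    simp only
    linarith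
  refine ⟨∑ i, ∫ μ, (1 / (2 * Real.cosh (Real.pi * μ))) * ‖y i μ‖ ^ 2 ∂volPlus,
    Finset.sum_nonneg fun i _ => (hb i).1, ?_, ?_⟩
  · rw [PiLp.norm_sq_eq_of_L2, Finset.sum_div]
    exact Finset.sum_le_sum fun i _ => (hb i).2
  · rw [PiLp.inner_apply, Complex.ofReal_sum, Finset.mul_sum]
    exact Finset.sum_congr rfl fun i _ => hk i

theorem modelOperator_approx {μ₀ : ℝ} (hμ : 0 ≤ μ₀) {ε : ℝ} (hε : 0 < ε) :
    ∃ x : ModelSpace, x ≠ 0 ∧ ‖modelOperator (modelOperator x) -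
      (Complex.I / (2 * Real.cosh (Real.pi * μ₀) : ℝ)) • x‖ ≤ ε * ‖x‖ ∧
      ‖inner ℂ x (modelOperator x)‖ ≤ ε * ‖x‖ ^ 2 := by
  set g : ℝ → ℂ := fun μ => Complex.I / (2 * Real.cosh (Real.pi * μ) : ℝ) with hg
  have hcont : Continuous g := by
    refine continuous_const.div (by fun_prop) fun μ => ?_
    have := Real.cosh_pos (Real.pi * μ)
    exact Complex.ofReal_ne_zero.2 (by positivity)
  obtain ⟨η, hη, hclose⟩ := Metric.continuous_iff.1 hcont μ₀ ε hε
  -- A one-sided interval stays inside the positive semiaxis even when `μ₀ = 0`.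
  set s : Set ℝ := Ioo μ₀ (μ₀ + η) with hs
  have hsub : s ⊆ Ioi 0 := fun t ht => lt_of_le_of_lt hμ ht.1
  have hvol : volPlus s = ENNReal.ofReal η := by
    rw [Measure.restrict_apply measurableSet_Ioo, inter_eq_left.2 hsub, hs, Real.volume_Ioo]
    simp
  have hfin : volPlus s ≠ ∞ := by rw [hvol]; exact ENNReal.ofReal_ne_top
  set f : L2Plus := indicatorConstLp 2 (μ := volPlus) (s := s) measurableSet_Ioo hfin (1 : ℂ)
    with hf
  have hfn : f ≠ 0 := by
    rw [← norm_pos_iff, hf, norm_indicatorConstLp (by simp) (by simp)]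
    rw [measureReal_def, hvol, ENNReal.toReal_ofReal hη.le]
    simp only [norm_one, one_mul]
    positivity
  have hfs : ∀ᵐ t ∂volPlus, f t = s.indicator (fun _ => (1 : ℂ)) t := indicatorConstLp_coeFn
  set x : ModelSpace := WithLp.toLp 2 ![f, 0] with hx
  have hx0 : x 0 = f := rfl
  have hx1 : x 1 = 0 := rfl
  refine ⟨x, ?_, ?_, ?_⟩
  · intro h
    apply hfn
    rw [← hx0, h]
    rfl
  · have hcomp : ∀ i, ‖(modelOperator (modelOperator x) - g μ₀ • x) i‖ ≤ ε * ‖x i‖ := by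
      intro i
      refine Lp.norm_le_mul_norm_of_ae_le_mul ?_
      have hsub : (modelOperator (modelOperator x) - g μ₀ • x) i
        = (modelOperator (modelOperator x)) i - g μ₀ • x i := rfl
      rw [hsub]
      have hsupp : ∀ᵐ t ∂volPlus, t ∉ s → x i t = 0 := by
        fin_cases i
        · filter_upwards [hfs] with t ht hts
          simp only [Fin.zero_eta, hx0]
          rw [ht, indicator_of_notMem hts]
        · filter_upwards [Lp.coeFn_zero ℂ 2 volPlus] with t ht _
          simp only [Fin.mk_one, hx1]
          rw [ht]; rfl
      filter_upwards [Lp.coeFn_sub ((modelOperator (modelOperator x)) i) (g μ₀ • x i),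
        Lp.coeFn_smul (g μ₀) (x i), modelOperator_sq_coeFn x i, hsupp] with t h1 h2 h3 h4
      rw [h1, Pi.sub_apply, h2, h3, Pi.smul_apply, smul_eq_mul, ← sub_mul, norm_mul]
      by_cases ht : t ∈ s
      · gcongr
        have := hclose t (by
          rw [Real.dist_eq, abs_of_pos (by linarith [ht.1])]
          linarith [ht.2])
        rw [dist_eq_norm] at this
        exact this.le
      · rw [h4 ht]
        simp
    have h1 : ‖modelOperator (modelOperator x) - g μ₀ • x‖ ^ 2 ≤ (ε * ‖x‖) ^ 2 := by
      rw [mul_pow, PiLp.norm_sq_eq_of_L2, PiLp.norm_sq_eq_of_L2, Finset.mul_sum]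
      refine Finset.sum_le_sum fun i _ => ?_
      rw [← mul_pow]
      exact pow_le_pow_left₀ (norm_nonneg _) (hcomp i) 2
    exact le_of_sq_le_sq h1 (by positivity)
  -- The matrix is antidiagonal: `x` lives in the first component and its image in the second.
  · have h0 : (modelOperator x) 0 = 0 := by
      apply Lp.ext
      filter_upwards [modelOperator_zero_coeFn x, Lp.coeFn_zero ℂ 2 volPlus] with t h1 h2
      rw [h1, h2, hx1, h2]
      simp
    have : inner ℂ x (modelOperator x) = 0 := by
      rw [PiLp.inner_apply, Fin.sum_univ_two, h0, hx1, inner_zero_left, inner_zero_right, add_zero]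
    rw [this, norm_zero]
    positivity

theorem spectrum_modelOperator :
    spectrum ℂ modelOperator = segment ℝ (-endpoint) endpoint :=
  spectrum_eq_segment modelOperator modelOperator_sq_form
    fun _ hμ _ hε => modelOperator_approx hμ hε

/-! ### Eigenvalues of the matrices `F(μ)`, including `μ = ∞`. -/

theorem spectrum_antidiagonal (a b z : ℂ) (h : z ^ 2 = a * b) :
    spectrum ℂ (!![0, a; b, 0] : Matrix (Fin 2) (Fin 2) ℂ) = {z, -z} := by
  ext w
  rw [spectrum.mem_iff, Matrix.isUnit_iff_isUnit_det, isUnit_iff_ne_zero, not_not,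
    Matrix.det_fin_two]
  simp [Matrix.algebraMap_matrix_apply]
  rw [← sq_eq_sq_iff_eq_or_eq_neg, h, sub_eq_zero, pow_two]

theorem spectrum_Fext (μ : ℝ≥0∞) : spectrum ℂ (Fext μ) = {zeta μ, -zeta μ} := by
  rcases eq_or_ne μ ∞ with rfl | hμ
  · rw [Fext, if_pos rfl]
    exact spectrum_antidiagonal _ _ _ (by simp [zeta_top])
  · rw [Fext, if_neg hμ]
    exact spectrum_antidiagonal _ _ _ (by rw [zeta_sq hμ, Fpm_mul_Fmp])

/-! ### The integral formula for integrable functions -/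

/-- The `L²` transform is defined by extension, so its agreement with the integral is checked
weakly. Against a smooth compactly supported `G`, both sides become the integral of `f` times the
transform of `G`: one through tempered distributions, the other through Fubini. -/
theorem fourierInv_coeFn_of_integrable (f : L2Line) (hf : Integrable f volume) :
    ((𝓕⁻ f : L2Line) : ℝ → ℂ) =ᵐ[volume] 𝓕⁻ (f : ℝ → ℂ) := by
  have hcont : Continuous (𝓕⁻ (f : ℝ → ℂ)) :=
    VectorFourier.fourierIntegral_continuous (L := -innerₗ ℝ) Real.continuous_fourierChar
      (by simp; fun_prop) hf
  refine ae_eq_of_integral_contDiff_smul_eq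
    ((Lp.memLp (𝓕⁻ f : L2Line)).locallyIntegrable (by norm_num)) hcont.locallyIntegrable ?_
  intro g g_smooth g_cpt
  have hg₁ : HasCompactSupport (Complex.ofRealCLM ∘ g) := g_cpt.comp_left rfl
  have hg₂ : ContDiff ℝ (⊤ : ℕ∞) (Complex.ofRealCLM ∘ g) := by fun_prop
  set G : SchwartzMap ℝ ℂ := hg₁.toSchwartzMap hg₂ with hG
  have hGg : ∀ t, G t = (g t : ℂ) := fun t => rfl
  have h1 := congrArg (fun T => T G) (Lp.fourierInv_toTemperedDistribution_eq f)
  simp only [TemperedDistribution.fourierInv_apply, Lp.toTemperedDistribution_apply] at h1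
  have h2 := VectorFourier.integral_fourierIntegral_smul_eq_flip (μ := volume) (ν := volume)
    (L := -innerₗ ℝ) (f := (G : ℝ → ℂ)) (g := (f : ℝ → ℂ)) Real.continuous_fourierChar
    (by simp; fun_prop) G.integrable hf
  have hflip : (-innerₗ ℝ : ℝ →ₗ[ℝ] ℝ →ₗ[ℝ] ℝ).flip = -innerₗ ℝ := by
    ext; simp
  rw [hflip] at h2
  have h3 : ∫ t, (g t : ℂ) • (𝓕⁻ f : L2Line) t = ∫ t, (g t : ℂ) • (𝓕⁻ (f : ℝ → ℂ)) t := by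
    simp only [← hGg]
    rw [← h1, SchwartzMap.fourierInv_coe]
    exact h2
  simpa using h3

theorem dilation_coeFn (g : L2Line) : dilation g =ᵐ[volume]
    fun t => ((Real.sqrt (2 * Real.pi))⁻¹ : ℂ) * g ((2 * Real.pi)⁻¹ * t) :=
  (memLp_dilation g).coeFn_toLp

theorem extendZero_coeFn (x : L2Plus) :
    extendZero x =ᵐ[volume] (Ioi (0 : ℝ)).indicator x :=
  ((memLp_indicator_iff_restrict measurableSet_Ioi).2 (Lp.memLp x)).coeFn_toLp

/-- The Laplace transform along the ray through `c`. -/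
def laplace (c : ℂ) (x : ℝ → ℂ) (t : ℝ) : ℂ :=
  ∫ ξ, x ξ * Complex.exp (-(c * ξ * t)) ∂volPlus

/-- The dilation by `2π` turns `e^{2πiξs}` at `s = t/2π` into `e^{iξt}`, which is the kernel of
`laplace` at `c = -i`. -/
theorem truncatedFourier_coeFn (x : L2Plus) (hx : Integrable x volPlus) :
    truncatedFourier x =ᵐ[volPlus]
      fun t => ((Real.sqrt (2 * Real.pi))⁻¹ : ℂ) * laplace (-Complex.I) x t := by
  have hE := extendZero_coeFn x
  have hint : Integrable (extendZero x) volume :=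
    ((integrable_indicator_iff measurableSet_Ioi).2 hx).congr hE.symm
  have h1 := quasi_dilation.ae (fourierInv_coeFn_of_integrable _ hint)
  have h2 : fourierPlancherel (extendZero x) =ᵐ[volume]
      fun t => ((Real.sqrt (2 * Real.pi))⁻¹ : ℂ) * laplace (-Complex.I) x t := by
    filter_upwards [dilation_coeFn (𝓕⁻ (extendZero x) : L2Line), h1] with t h3 h4
    have h5 : fourierPlancherel (extendZero x) = dilation (𝓕⁻ (extendZero x) : L2Line) := rfl
    rw [h5, h3, h4, Real.fourierInv_congr_ae hE, Real.fourierInv_eq', laplace]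
    congr 1
    rw [← integral_indicator measurableSet_Ioi]
    congr 1
    ext ξ
    by_cases hξ : ξ ∈ Ioi (0 : ℝ)
    · rw [indicator_of_mem hξ, indicator_of_mem hξ, smul_eq_mul, mul_comm]
      congr 2
      have : (Real.pi : ℂ) ≠ 0 := Complex.ofReal_ne_zero.2 Real.pi_ne_zero
      simp only [RCLike.inner_apply]
      simp
      field_simp
    · rw [indicator_of_notMem hξ, indicator_of_notMem hξ, smul_zero]
  have h6 : truncatedFourier x = restrictPlus (fourierPlancherel (extendZero x)) := rfl
  rw [h6]
  have h7 := LpToLpRestrictCLM_coeFn ℂ (Ioi (0 : ℝ)) (fourierPlancherel (extendZero x))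
  exact h7.trans (ae_restrict_of_ae h2)

/-! ### The bilinear pairing -/

/-- The bilinear pairing `∫ x y` on `L²(ℝ⁺)`. -/
def pairing : L2Plus →L[ℂ] L2Plus →L[ℂ] ℂ :=
  (ContinuousLinearMap.mul ℂ ℂ).lpPairing volPlus 2 2

theorem pairing_apply (x y : L2Plus) : pairing x y = ∫ t, x t * y t ∂volPlus := by
  rw [pairing, ContinuousLinearMap.lpPairing_eq_integral]
  rfl

theorem pairing_star (x y : L2Plus) : pairing y (star x) = inner ℂ x y := by
  rw [pairing_apply, L2.inner_def]
  refine integral_congr_ae ?_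
  filter_upwards [Lp.coeFn_star x] with t ht
  rw [ht]
  rfl

theorem dense_integrable : Dense {x : L2Plus | Integrable x volPlus} := by
  refine (Lp.simpleFunc.denseRange (α := ℝ) (E := ℂ) (p := 2) (μ := volPlus)
    (by norm_num)).mono ?_
  rintro _ ⟨f, rfl⟩
  have h1 := (SimpleFunc.memLp_iff_integrable two_ne_zero (by norm_num)).1
    (Lp.simpleFunc.memLp f)
  exact h1.congr (Lp.simpleFunc.toSimpleFunc_eq_toFun f)

theorem eq_of_pairing_eq {v w : L2Plus}
    (h : ∀ y : L2Plus, Integrable y volPlus → pairing v y = pairing w y) : v = w := by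
  have h1 : ∀ y, pairing v y = pairing w y := fun y =>
    dense_integrable.induction (P := fun y => pairing v y = pairing w y) h
      (isClosed_eq (pairing v).continuous (pairing w).continuous) y
  refine ext_inner_left ℂ fun x => ?_
  rw [← pairing_star, ← pairing_star, h1]

/-- Planar Lebesgue measure on the open first quadrant. -/
abbrev volQuad : Measure (ℝ × ℝ) := volPlus.prod volPlus

theorem ae_volPlus_pos : ∀ᵐ t ∂volPlus, 0 < t := ae_restrict_mem measurableSet_Ioi

theorem ae_volQuad_pos : ∀ᵐ p ∂volQuad, 0 < p.1 ∧ 0 < p.2 := by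
  rw [volQuad, Measure.prod_restrict]
  exact ae_restrict_mem (measurableSet_Ioi.prod measurableSet_Ioi)

theorem norm_exp_neg_le_one {c : ℂ} (hc : 0 ≤ c.re) {u t : ℝ} (hu : 0 ≤ u) (ht : 0 ≤ t) :
    ‖Complex.exp (-(c * u * t))‖ ≤ 1 := by
  rw [Complex.norm_exp, Real.exp_le_one_iff]
  simp only [Complex.neg_re, Complex.mul_re, Complex.ofReal_re, Complex.ofReal_im, mul_zero,
    sub_zero]
  have := mul_nonneg (mul_nonneg hc hu) ht
  linarith

theorem integral_laplace_mul (x y : ℝ → ℂ) (hx : Integrable x volPlus)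
    (hy : Integrable y volPlus) {c : ℂ} (hc : 0 ≤ c.re) :
    ∫ t, laplace c x t * y t ∂volPlus = ∫ t, x t * laplace c y t ∂volPlus := by
  have hint : Integrable (Function.uncurry fun t ξ : ℝ =>
      Complex.exp (-(c * ξ * t)) * (y t * x ξ)) volQuad := by
    have h0 : Integrable (fun p : ℝ × ℝ => y p.1 * x p.2) volQuad := hy.mul_prod hx
    have hm : AEStronglyMeasurable (fun p : ℝ × ℝ => Complex.exp (-(c * p.2 * p.1))) volQuad :=
      Continuous.aestronglyMeasurable (by fun_prop)
    refine h0.bdd_mul (c := 1) hm ?_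
    filter_upwards [ae_volQuad_pos] with p hp
    exact norm_exp_neg_le_one hc hp.2.le hp.1.le
  have hs := integral_integral_swap hint
  calc ∫ t, laplace c x t * y t ∂volPlus
      = ∫ t, ∫ ξ, Complex.exp (-(c * ξ * t)) * (y t * x ξ) ∂volPlus ∂volPlus := by
        refine integral_congr_ae (Eventually.of_forall fun t => ?_)
        simp only [laplace]
        rw [← integral_mul_const]
        congr 1
        ext ξ
        ring
    _ = ∫ ξ, ∫ t, Complex.exp (-(c * ξ * t)) * (y t * x ξ) ∂volPlus ∂volPlus := hs
    _ = _ := by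
        refine integral_congr_ae (Eventually.of_forall fun t => ?_)
        simp only [laplace]
        rw [← integral_const_mul]
        congr 1
        ext ξ
        rw [mul_right_comm c]
        ring

/-- The kernel `e^{iξt}` is symmetric, not Hermitian, so the operator moves across the bilinear
pairing without conjugation. Fubini gives this for integrable functions, and density with continuity
gives the rest. -/
theorem pairing_truncatedFourier (x y : L2Plus) :
    pairing (truncatedFourier x) y = pairing x (truncatedFourier y) := by
  have h1 : ∀ x y : L2Plus, Integrable x volPlus → Integrable y volPlus →
      pairing (truncatedFourier x) y = pairing x (truncatedFourier y) := by
    intro x y hx hy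
    rw [pairing_apply, pairing_apply]
    calc ∫ t, truncatedFourier x t * y t ∂volPlus
        = ((Real.sqrt (2 * Real.pi))⁻¹ : ℂ) * ∫ t, laplace (-Complex.I) x t * y t ∂volPlus := by
          rw [← integral_const_mul]
          refine integral_congr_ae ?_
          filter_upwards [truncatedFourier_coeFn x hx] with t ht
          rw [ht]
          ring
      _ = ((Real.sqrt (2 * Real.pi))⁻¹ : ℂ) * ∫ t, x t * laplace (-Complex.I) y t ∂volPlus := by
          rw [integral_laplace_mul x y hx hy (by simp)]
      _ = _ := by
          rw [← integral_const_mul]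
          refine integral_congr_ae ?_
          filter_upwards [truncatedFourier_coeFn y hy] with t ht
          rw [ht]
          ring
  refine dense_integrable.induction
    (P := fun x => pairing (truncatedFourier x) y = pairing x (truncatedFourier y))
    (fun x hx => ?_) (isClosed_eq ?_ ?_) x
  · refine dense_integrable.induction
      (P := fun y => pairing (truncatedFourier x) y = pairing x (truncatedFourier y))
      (fun y hy => h1 x y hx hy) (isClosed_eq ?_ ?_) y
    · exact (pairing (truncatedFourier x)).continuous
    · exact ((pairing x).comp truncatedFourier).continuous
  · exact ((pairing.flip y).comp truncatedFourier).continuous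
  · exact (pairing.flip (truncatedFourier y)).continuous

/-! ### The Carleman kernel -/

/-- The weight of the Schur test for the kernel `1 / (ξ + η)`. -/
def schurKernel (ξ η : ℝ) : ℝ := Real.sqrt ξ / (Real.sqrt η * (ξ + η))

theorem schurKernel_nonneg {ξ η : ℝ} (hξ : 0 ≤ ξ) (hη : 0 ≤ η) : 0 ≤ schurKernel ξ η := by
  unfold schurKernel
  positivity

/-- An antiderivative in `η` is `2 arctan √(η/ξ)`, which rises from `0` to `π`; this is the source
of the sharp constant. -/
theorem schurKernel_integral {ξ : ℝ} (hξ : 0 < ξ) :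
    Integrable (schurKernel ξ) volPlus ∧ ∫ η, schurKernel ξ η ∂volPlus = Real.pi := by
  have hs : 0 < Real.sqrt ξ := Real.sqrt_pos.2 hξ
  set g : ℝ → ℝ := fun η => 2 * Real.arctan (Real.sqrt η / Real.sqrt ξ) with hg
  have hcont : Continuous g := by fun_prop
  have hd : ∀ η ∈ Ioi (0 : ℝ), HasDerivAt g (schurKernel ξ η) η := by
    intro η hη
    have hη' : (0 : ℝ) < η := hη
    have hsη : 0 < Real.sqrt η := Real.sqrt_pos.2 hη'
    have h1 := (((Real.hasDerivAt_sqrt hη'.ne').div_const (Real.sqrt ξ)).arctan).const_mul 2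
    convert! h1 using 1
    unfold schurKernel
    have e1 := Real.sq_sqrt hξ.le
    have e2 := Real.sq_sqrt hη'.le
    rw [div_pow, e1, e2]
    field_simp
    rw [e1]
  have hn : ∀ η ∈ Ioi (0 : ℝ), 0 ≤ schurKernel ξ η := fun η hη =>
    schurKernel_nonneg hξ.le (le_of_lt hη)
  have hl : Tendsto g atTop (nhds Real.pi) := by
    have h1 : Tendsto (fun η : ℝ => Real.sqrt η / Real.sqrt ξ) atTop atTop :=
      Real.tendsto_sqrt_atTop.atTop_div_const hs
    have h2 := ((Real.tendsto_arctan_atTop.mono_right nhdsWithin_le_nhds).comp h1).const_mul 2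
    rw [mul_div_cancel₀ _ two_ne_zero] at h2
    exact h2
  refine ⟨integrableOn_Ioi_deriv_of_nonneg hcont.continuousWithinAt hd hn hl, ?_⟩
  rw [integral_Ioi_of_hasDerivAt_of_nonneg hcont.continuousWithinAt hd hn hl]
  simp [hg]

theorem measurable_schurKernel : Measurable fun p : ℝ × ℝ => schurKernel p.1 p.2 := by
  unfold schurKernel
  fun_prop

theorem schur_integral (x : L2Plus) :
    Integrable (fun p : ℝ × ℝ => ‖x p.1‖ ^ 2 * schurKernel p.1 p.2) volQuad ∧
      ∫ p, ‖x p.1‖ ^ 2 * schurKernel p.1 p.2 ∂volQuad = Real.pi * ‖x‖ ^ 2 := by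
  have hm : AEStronglyMeasurable (fun p : ℝ × ℝ => ‖x p.1‖ ^ 2 * schurKernel p.1 p.2) volQuad :=
    ((Lp.aestronglyMeasurable x).comp_fst.norm.pow 2).mul
      measurable_schurKernel.aestronglyMeasurable
  have hi : Integrable (fun p : ℝ × ℝ => ‖x p.1‖ ^ 2 * schurKernel p.1 p.2) volQuad := by
    rw [integrable_prod_iff hm]
    constructor
    · filter_upwards [ae_volPlus_pos] with ξ hξ
      exact (schurKernel_integral hξ).1.const_mul _
    · refine ((integrable_norm_sq x).mul_const Real.pi).congr ?_
      filter_upwards [ae_volPlus_pos] with ξ hξ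
      rw [← (schurKernel_integral hξ).2, ← integral_const_mul]
      refine integral_congr_ae ?_
      filter_upwards [ae_volPlus_pos] with η hη
      rw [Real.norm_of_nonneg]
      exact mul_nonneg (sq_nonneg _) (schurKernel_nonneg hξ.le hη.le)
  refine ⟨hi, ?_⟩
  rw [integral_prod _ hi, norm_sq_eq_integral, ← integral_const_mul]
  refine integral_congr_ae ?_
  filter_upwards [ae_volPlus_pos] with ξ hξ
  rw [integral_const_mul, (schurKernel_integral hξ).2, mul_comm]

/-- The arithmetic-geometric mean inequality for `‖a‖√ξ` and `‖b‖√η`: the difference of the two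
sides is a square over a positive denominator. -/
theorem norm_carleman_le {ξ η : ℝ} (hξ : 0 < ξ) (hη : 0 < η) (a b : ℂ) :
    ‖a * b / ((ξ + η : ℝ) : ℂ)‖ ≤
      (‖a‖ ^ 2 * schurKernel ξ η + ‖b‖ ^ 2 * schurKernel η ξ) / 2 := by
  have hs : 0 < Real.sqrt ξ := Real.sqrt_pos.2 hξ
  have ht : 0 < Real.sqrt η := Real.sqrt_pos.2 hη
  rw [norm_div, norm_mul, Complex.norm_real, Real.norm_of_nonneg (by positivity)]
  unfold schurKernel
  rw [add_comm η ξ]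
  have h : (‖a‖ ^ 2 * (Real.sqrt ξ / (Real.sqrt η * (ξ + η))) +
      ‖b‖ ^ 2 * (Real.sqrt η / (Real.sqrt ξ * (ξ + η)))) / 2 - ‖a‖ * ‖b‖ / (ξ + η)
      = (‖a‖ * Real.sqrt ξ - ‖b‖ * Real.sqrt η) ^ 2 /
        (2 * Real.sqrt ξ * Real.sqrt η * (ξ + η)) := by
    field_simp
    ring
  have h2 : 0 ≤ (‖a‖ * Real.sqrt ξ - ‖b‖ * Real.sqrt η) ^ 2 /
        (2 * Real.sqrt ξ * Real.sqrt η * (ξ + η)) := by positivity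
  linarith

theorem schur_integral_swap (x : L2Plus) :
    Integrable (fun p : ℝ × ℝ => ‖x p.2‖ ^ 2 * schurKernel p.2 p.1) volQuad ∧
      ∫ p, ‖x p.2‖ ^ 2 * schurKernel p.2 p.1 ∂volQuad = Real.pi * ‖x‖ ^ 2 := by
  obtain ⟨h1, h2⟩ := schur_integral x
  refine ⟨h1.swap, ?_⟩
  rw [← h2]
  exact integral_prod_swap (fun p : ℝ × ℝ => ‖x p.1‖ ^ 2 * schurKernel p.1 p.2)

theorem integrable_carleman (x y : L2Plus) :
    Integrable (fun p : ℝ × ℝ => x p.1 * y p.2 / ((p.1 + p.2 : ℝ) : ℂ)) volQuad := by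
  refine (((schur_integral x).1.add (schur_integral_swap y).1).div_const 2).mono' ?_ ?_
  · simp only [div_eq_mul_inv]
    have hm : Measurable fun p : ℝ × ℝ => (((p.1 + p.2 : ℝ) : ℂ))⁻¹ := by fun_prop
    exact ((Lp.aestronglyMeasurable x).comp_fst.mul (Lp.aestronglyMeasurable y).comp_snd).mul
      hm.aestronglyMeasurable
  · filter_upwards [ae_volQuad_pos] with p hp
    exact norm_carleman_le hp.1 hp.2 _ _

theorem norm_carleman_form_le (x : L2Plus) :
    ‖∫ p, x p.1 * star (x p.2) / ((p.1 + p.2 : ℝ) : ℂ) ∂volQuad‖ ≤ Real.pi * ‖x‖ ^ 2 := by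
  have h : ∫ p, (‖x p.1‖ ^ 2 * schurKernel p.1 p.2 + ‖x p.2‖ ^ 2 * schurKernel p.2 p.1) / 2
      ∂volQuad = Real.pi * ‖x‖ ^ 2 := by
    rw [integral_div, integral_add (schur_integral x).1 (schur_integral_swap x).1,
      (schur_integral x).2, (schur_integral_swap x).2]
    ring
  rw [← h]
  refine norm_integral_le_of_norm_le
    (((schur_integral x).1.add (schur_integral_swap x).1).div_const 2) ?_
  filter_upwards [ae_volQuad_pos] with p hp
  have := norm_carleman_le hp.1 hp.2 (x p.1) (star (x p.2))
  rwa [norm_star] at this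

/-! ### The square of the truncated Fourier operator -/

/-- By Fubini, the `t`-integral of `e^{-(ε + c(ξ+η))t}` is the new kernel. The damping `ε` is what
makes it converge absolutely for imaginary `c`. The case `c = -i` computes the square, and `c = 1`
shows positivity. -/
theorem integral_exp_mul_laplace_mul_laplace (x y : ℝ → ℂ) (hx : Integrable x volPlus)
    (hy : Integrable y volPlus) {c : ℂ} (hc : 0 ≤ c.re) {ε : ℝ} (hε : 0 < ε) :
    ∫ t, (Real.exp (-ε * t) : ℂ) * (laplace c x t * laplace c y t) ∂volPlus
      = ∫ p, x p.1 * y p.2 / (ε + c * (p.1 + p.2 : ℝ)) ∂volQuad := by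
  have hxy : Integrable (fun p : ℝ × ℝ => x p.1 * y p.2) volQuad := hx.mul_prod hy
  have hexp : Integrable (fun t : ℝ => (Real.exp (-ε * t) : ℂ)) volPlus :=
    (exp_neg_integrableOn_Ioi 0 hε).ofReal
  have hint : Integrable (Function.uncurry fun (t : ℝ) (p : ℝ × ℝ) =>
      Complex.exp (-(c * (p.1 + p.2 : ℝ) * t)) * ((Real.exp (-ε * t) : ℂ) * (x p.1 * y p.2)))
      (volPlus.prod volQuad) := by
    have h0 : Integrable (fun q : ℝ × ℝ × ℝ => (Real.exp (-ε * q.1) : ℂ) *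
      (x q.2.1 * y q.2.2)) (volPlus.prod volQuad) := hexp.mul_prod hxy
    have hm : AEStronglyMeasurable (fun q : ℝ × ℝ × ℝ =>
        Complex.exp (-(c * (q.2.1 + q.2.2 : ℝ) * q.1))) (volPlus.prod volQuad) :=
      Continuous.aestronglyMeasurable (by fun_prop)
    refine h0.bdd_mul (c := 1) hm ?_
    have h1 : ∀ᵐ q ∂(volPlus.prod volQuad), 0 < q.1 :=
      Measure.quasiMeasurePreserving_fst.ae ae_volPlus_pos
    have h2 : ∀ᵐ q ∂(volPlus.prod volQuad), 0 < q.2.1 ∧ 0 < q.2.2 :=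
      Measure.quasiMeasurePreserving_snd.ae ae_volQuad_pos
    filter_upwards [h1, h2] with q h3 h4
    exact norm_exp_neg_le_one hc (add_pos h4.1 h4.2).le h3.le
  calc ∫ t, (Real.exp (-ε * t) : ℂ) * (laplace c x t * laplace c y t) ∂volPlus
      = ∫ t, ∫ p, Complex.exp (-(c * (p.1 + p.2 : ℝ) * t)) *
          ((Real.exp (-ε * t) : ℂ) * (x p.1 * y p.2)) ∂volQuad ∂volPlus := by
        refine integral_congr_ae (Eventually.of_forall fun t => ?_)
        simp only [laplace]
        rw [← integral_prod_mul, ← integral_const_mul]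
        congr 1
        ext p
        have : Complex.exp (-(c * (p.1 + p.2 : ℝ) * t))
            = Complex.exp (-(c * p.1 * t)) * Complex.exp (-(c * p.2 * t)) := by
          rw [← Complex.exp_add]
          congr 1
          push_cast
          ring
        rw [this]
        ring
    _ = ∫ p, ∫ t, Complex.exp (-(c * (p.1 + p.2 : ℝ) * t)) *
          ((Real.exp (-ε * t) : ℂ) * (x p.1 * y p.2)) ∂volPlus ∂volQuad :=
        integral_integral_swap hint
    _ = _ := by
        refine integral_congr_ae ?_
        filter_upwards [ae_volQuad_pos] with p hp
        have hre : (-(ε + c * (p.1 + p.2 : ℝ)) : ℂ).re < 0 := by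
          simp only [Complex.neg_re, Complex.add_re, Complex.mul_re, Complex.ofReal_re,
            Complex.ofReal_im, mul_zero, sub_zero]
          have := mul_nonneg hc (add_pos hp.1 hp.2).le
          linarith
        have h1 := integral_exp_mul_complex_Ioi hre 0
        calc ∫ t, Complex.exp (-(c * (p.1 + p.2 : ℝ) * t)) *
              ((Real.exp (-ε * t) : ℂ) * (x p.1 * y p.2)) ∂volPlus
            = (∫ t, Complex.exp (-(ε + c * (p.1 + p.2 : ℝ)) * t) ∂volPlus) *
                (x p.1 * y p.2) := by
              rw [← integral_mul_const]
              congr 1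
              ext t
              have : Complex.exp (-(ε + c * (p.1 + p.2 : ℝ)) * t)
                  = Complex.exp (-(c * (p.1 + p.2 : ℝ) * t)) * (Real.exp (-ε * t) : ℂ) := by
                rw [Complex.ofReal_exp, ← Complex.exp_add]
                congr 1
                push_cast
                ring
              rw [this]
              ring
          _ = _ := by
              rw [h1, Complex.ofReal_zero, mul_zero, Complex.exp_zero, neg_div_neg_eq,
                div_mul_eq_mul_div, one_mul]

/-- Since `|ε + cu|² = ε² + 2ε Re(c) u + u²`, the kernel `1/u` dominates all the damped kernels,
uniformly in `ε`. -/
theorem le_norm_add_mul {c : ℂ} (hc : 0 ≤ c.re) (hc1 : ‖c‖ = 1) {ε u : ℝ} (hε : 0 ≤ ε)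
    (hu : 0 ≤ u) : u ≤ ‖(ε + c * u : ℂ)‖ := by
  have h1 : c.re * c.re + c.im * c.im = 1 := by
    have := Complex.normSq_apply c
    rw [Complex.normSq_eq_norm_sq, hc1] at this
    linarith
  refine le_of_sq_le_sq ?_ (norm_nonneg _)
  rw [← Complex.normSq_eq_norm_sq, Complex.normSq_apply]
  simp only [Complex.add_re, Complex.mul_re, Complex.ofReal_re, Complex.ofReal_im, mul_zero,
    sub_zero, Complex.add_im, Complex.mul_im, zero_add]
  have h2 := mul_nonneg (mul_nonneg hε hc) hu
  have h3 : (ε + c.re * u) * (ε + c.re * u) + c.im * u * (c.im * u)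
      = ε ^ 2 + 2 * (ε * c.re * u) + (c.re * c.re + c.im * c.im) * u ^ 2 := by ring
  rw [h3, h1]
  nlinarith [sq_nonneg ε]

theorem tendsto_carleman (x y : L2Plus) {c : ℂ} (hc : 0 ≤ c.re) (hc1 : ‖c‖ = 1) :
    Tendsto (fun ε : ℝ => ∫ p, x p.1 * y p.2 / (ε + c * (p.1 + p.2 : ℝ)) ∂volQuad)
      (nhdsWithin 0 (Ioi 0))
      (nhds (c⁻¹ * ∫ p, x p.1 * y p.2 / ((p.1 + p.2 : ℝ) : ℂ) ∂volQuad)) := by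
  rw [← integral_const_mul]
  refine tendsto_integral_filter_of_dominated_convergence
    (fun p => ‖x p.1 * y p.2 / ((p.1 + p.2 : ℝ) : ℂ)‖) ?_ ?_ (integrable_carleman x y).norm ?_
  · refine Eventually.of_forall fun ε => ?_
    simp only [div_eq_mul_inv]
    have hm : Measurable fun p : ℝ × ℝ => (ε + c * (p.1 + p.2 : ℝ) : ℂ)⁻¹ := by fun_prop
    exact ((Lp.aestronglyMeasurable x).comp_fst.mul (Lp.aestronglyMeasurable y).comp_snd).mul
      hm.aestronglyMeasurable
  · filter_upwards [self_mem_nhdsWithin] with ε hε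
    filter_upwards [ae_volQuad_pos] with p hp
    have hu : 0 < p.1 + p.2 := add_pos hp.1 hp.2
    rw [norm_div, norm_div (x p.1 * y p.2), Complex.norm_real, Real.norm_of_nonneg hu.le]
    gcongr
    exact le_norm_add_mul hc hc1 (le_of_lt hε) hu.le
  · filter_upwards [ae_volQuad_pos] with p hp
    have hu : ((p.1 + p.2 : ℝ) : ℂ) ≠ 0 := Complex.ofReal_ne_zero.2 (add_pos hp.1 hp.2).ne'
    have hc0 : c ≠ 0 := norm_ne_zero_iff.1 (by rw [hc1]; exact one_ne_zero)
    have h1 : c⁻¹ * (x p.1 * y p.2 / ((p.1 + p.2 : ℝ) : ℂ))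
        = x p.1 * y p.2 / (((0 : ℝ) : ℂ) + c * (p.1 + p.2 : ℝ)) := by
      rw [Complex.ofReal_zero, zero_add]
      field_simp
    rw [h1]
    refine Tendsto.mono_left (ContinuousAt.tendsto ?_) nhdsWithin_le_nhds
    refine ContinuousAt.div continuousAt_const (by fun_prop) ?_
    rw [Complex.ofReal_zero, zero_add]
    exact mul_ne_zero hc0 hu

theorem pairing_truncatedFourier_sq (x y : L2Plus) (hx : Integrable x volPlus)
    (hy : Integrable y volPlus) :
    pairing (truncatedFourier (truncatedFourier x)) y
      = Complex.I / (2 * Real.pi) * ∫ p, x p.1 * y p.2 / ((p.1 + p.2 : ℝ) : ℂ) ∂volQuad := by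
  rw [pairing_truncatedFourier, pairing_apply]
  have hs : ((Real.sqrt (2 * Real.pi) : ℂ))⁻¹ * (Real.sqrt (2 * Real.pi) : ℂ)⁻¹
      = (2 * Real.pi : ℂ)⁻¹ := by
    rw [← mul_inv, ← Complex.ofReal_mul, Real.mul_self_sqrt (by positivity)]
    push_cast
    rfl
  have hpi : (2 * Real.pi : ℂ) ≠ 0 :=
    mul_ne_zero two_ne_zero (Complex.ofReal_ne_zero.2 Real.pi_ne_zero)
  have hae : ∀ᵐ t ∂volPlus, laplace (-Complex.I) x t * laplace (-Complex.I) y t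
      = (2 * Real.pi : ℂ) * (truncatedFourier x t * truncatedFourier y t) := by
    filter_upwards [truncatedFourier_coeFn x hx, truncatedFourier_coeFn y hy] with t h1 h2
    rw [h1, h2, mul_mul_mul_comm _ _ _ (laplace _ _ _), hs, ← mul_assoc,
      mul_inv_cancel₀ hpi, one_mul]
  have hint : Integrable (fun t => laplace (-Complex.I) x t * laplace (-Complex.I) y t)
      volPlus := by
    have h1 : Integrable (fun t => truncatedFourier x t * truncatedFourier y t) volPlus :=
      (Lp.memLp (truncatedFourier x)).integrable_mul (Lp.memLp (truncatedFourier y))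
    exact (h1.const_mul _).congr (hae.mono fun t ht => ht.symm)
  have hl : Tendsto (fun ε : ℝ => ∫ t, (Real.exp (-ε * t) : ℂ) *
      (laplace (-Complex.I) x t * laplace (-Complex.I) y t) ∂volPlus) (nhdsWithin 0 (Ioi 0))
      (nhds (∫ t, laplace (-Complex.I) x t * laplace (-Complex.I) y t ∂volPlus)) := by
    refine tendsto_integral_filter_of_dominated_convergence
      (fun t => ‖laplace (-Complex.I) x t * laplace (-Complex.I) y t‖) ?_ ?_ hint.norm ?_
    · refine Eventually.of_forall fun ε => ?_
      exact (Continuous.aestronglyMeasurable (by fun_prop)).mul hint.aestronglyMeasurable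
    · filter_upwards [self_mem_nhdsWithin] with ε hε
      filter_upwards [ae_volPlus_pos] with t ht
      rw [norm_mul, Complex.norm_real, Real.norm_of_nonneg (Real.exp_pos _).le]
      refine mul_le_of_le_one_left (norm_nonneg _) ?_
      rw [Real.exp_le_one_iff]
      have := mul_pos (show (0 : ℝ) < ε from hε) ht
      linarith
    · refine Eventually.of_forall fun t => ?_
      have h1 : Continuous fun ε : ℝ => (Real.exp (-ε * t) : ℂ) *
        (laplace (-Complex.I) x t * laplace (-Complex.I) y t) := by fun_prop
      have h2 := h1.tendsto 0
      simp only [neg_zero, zero_mul, Real.exp_zero, Complex.ofReal_one, one_mul] at h2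
      exact h2.mono_left nhdsWithin_le_nhds
  have hr := tendsto_carleman x y (c := -Complex.I) (by simp) (by simp)
  -- The limit of the damped integrals as `ε → 0⁺`, evaluated on the `t` side and on the Carleman
  -- side.
  have heq : ∫ t, laplace (-Complex.I) x t * laplace (-Complex.I) y t ∂volPlus
      = (-Complex.I)⁻¹ * ∫ p, x p.1 * y p.2 / ((p.1 + p.2 : ℝ) : ℂ) ∂volQuad := by
    refine tendsto_nhds_unique (hl.congr' ?_) hr
    filter_upwards [self_mem_nhdsWithin] with ε hε
    exact integral_exp_mul_laplace_mul_laplace x y hx hy (by simp) hε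
  rw [integral_congr_ae hae, integral_const_mul] at heq
  have h3 : ∫ t, truncatedFourier x t * truncatedFourier y t ∂volPlus
      = (2 * Real.pi : ℂ)⁻¹ * ((-Complex.I)⁻¹ *
        ∫ p, x p.1 * y p.2 / ((p.1 + p.2 : ℝ) : ℂ) ∂volQuad) := by
    rw [← heq, ← mul_assoc, inv_mul_cancel₀ hpi, one_mul]
  rw [h3, inv_neg, Complex.inv_I, neg_neg]
  ring

/-! ### Positivity of the Carleman form and the form of the square. -/

theorem integrable_star {x : L2Plus} (hx : Integrable x volPlus) :
    Integrable (star x : L2Plus) volPlus := by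
  refine hx.mono (Lp.aestronglyMeasurable _) ?_
  filter_upwards [Lp.coeFn_star x] with t ht
  rw [ht, Pi.star_apply, norm_star]

theorem laplace_star (x : ℝ → ℂ) (t : ℝ) :
    laplace 1 (fun ξ => star (x ξ)) t = star (laplace 1 x t) := by
  simp only [laplace]
  rw [Complex.star_def, ← integral_conj]
  congr 1
  ext ξ
  rw [map_mul, ← Complex.exp_conj]
  simp

/-- For `c = 1` and `y = star x` the damped form is `∫ e^{-εt} |laplace 1 x t|² dt ≥ 0`; being real
and nonnegative survives the limit. -/
theorem carleman_form_nonneg (x : L2Plus) (hx : Integrable x volPlus) :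
    ∃ r : ℝ, 0 ≤ r ∧
      ∫ p, x p.1 * star x p.2 / ((p.1 + p.2 : ℝ) : ℂ) ∂volQuad = (r : ℂ) := by
  have hsx : Integrable (star x : L2Plus) volPlus := integrable_star hx
  have hcl : IsClosed {z : ℂ | 0 ≤ z.re ∧ z.im = 0} :=
    (isClosed_le continuous_const Complex.continuous_re).inter
      (isClosed_eq Complex.continuous_im continuous_const)
  have hlim := tendsto_carleman x (star x) (c := 1) (by simp) (by simp)
  have hmem := hcl.mem_of_tendsto hlim (by
    filter_upwards [self_mem_nhdsWithin] with ε hε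
    rw [← integral_exp_mul_laplace_mul_laplace x (star x : L2Plus) hx hsx (by simp) hε]
    have h1 : ∀ t, (Real.exp (-ε * t) : ℂ) * (laplace 1 x t * laplace 1 (star x : L2Plus) t)
        = ((Real.exp (-ε * t) * ‖laplace 1 x t‖ ^ 2 : ℝ) : ℂ) := by
      intro t
      have h2 : laplace 1 (star x : L2Plus) t = star (laplace 1 x t) := by
        rw [← laplace_star]
        refine integral_congr_ae ?_
        filter_upwards [Lp.coeFn_star x] with ξ hξ
        rw [hξ]
        rfl
      rw [h2, Complex.star_def, Complex.mul_conj, Complex.normSq_eq_norm_sq]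
      push_cast
      rfl
    simp only [h1, integral_complex_ofReal]
    refine ⟨?_, Complex.ofReal_im _⟩
    rw [Complex.ofReal_re]
    exact integral_nonneg fun t => mul_nonneg (Real.exp_pos _).le (sq_nonneg _))
  rw [inv_one, one_mul] at hmem
  exact ⟨_, hmem.1, Complex.ext rfl hmem.2⟩

theorem truncatedFourier_sq_form (x : L2Plus) : ∃ r : ℝ, 0 ≤ r ∧ r ≤ ‖x‖ ^ 2 / 2 ∧
    inner ℂ x (truncatedFourier (truncatedFourier x)) = Complex.I * r := by
  set q : L2Plus → ℂ := fun x => -Complex.I * inner ℂ x (truncatedFourier (truncatedFourier x))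
    with hq
  have hqc : Continuous q := by fun_prop
  -- Stated through `q`, the claim is a closed condition on `x`, so it extends from the dense set of
  -- integrable functions.
  suffices h : ∀ x : L2Plus, 0 ≤ (q x).re ∧ (q x).re ≤ ‖x‖ ^ 2 / 2 ∧ (q x).im = 0 by
    obtain ⟨h1, h2, h3⟩ := h x
    refine ⟨_, h1, h2, ?_⟩
    have h4 : ((q x).re : ℂ) = q x := Complex.ext rfl (by simp [h3])
    rw [h4, hq, ← mul_assoc]
    simp
  clear x
  intro x
  refine dense_integrable.induction
    (P := fun x => 0 ≤ (q x).re ∧ (q x).re ≤ ‖x‖ ^ 2 / 2 ∧ (q x).im = 0) ?_ ?_ x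
  · intro x hx
    have hsx : Integrable (star x : L2Plus) volPlus := integrable_star hx
    obtain ⟨r, hr0, hr⟩ := carleman_form_nonneg x hx
    have h1 : q x = ((r / (2 * Real.pi) : ℝ) : ℂ) := by
      simp only [hq]
      rw [← pairing_star, pairing_truncatedFourier_sq x (star x) hx hsx, hr, ← mul_assoc,
        ← mul_div_assoc]
      simp
      ring
    have h2 : r ≤ Real.pi * ‖x‖ ^ 2 := by
      have h3 := norm_carleman_form_le x
      have h4 : ∫ p, x p.1 * star (x p.2) / ((p.1 + p.2 : ℝ) : ℂ) ∂volQuad = (r : ℂ) := by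
        rw [← hr]
        refine integral_congr_ae ?_
        filter_upwards [Measure.quasiMeasurePreserving_snd.ae (Lp.coeFn_star x)] with p hp
        rw [hp]
        rfl
      rwa [h4, Complex.norm_real, Real.norm_of_nonneg hr0] at h3
    rw [h1, Complex.ofReal_re, Complex.ofReal_im]
    have hpi := Real.pi_pos
    refine ⟨by positivity, ?_, rfl⟩
    rw [div_le_div_iff₀ (by positivity) (by positivity)]
    nlinarith
  · refine (isClosed_le continuous_const (Complex.continuous_re.comp hqc)).inter
      ((isClosed_le (Complex.continuous_re.comp hqc) (by fun_prop)).inter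
      (isClosed_eq (Complex.continuous_im.comp hqc) continuous_const))

/-! ### Approximate eigenvectors of the truncated Fourier operator -/

theorem inv_cpow_of_pos {u : ℝ} (hu : 0 < u) (s : ℂ) : (1 / (u : ℂ)) ^ s = (u : ℂ) ^ (-s) := by
  rw [one_div, Complex.inv_cpow _ _ (by
    rw [Complex.arg_ofReal_of_nonneg hu.le]; exact Real.pi_ne_zero.symm), Complex.cpow_neg]

theorem norm_cpow_sub_one {t : ℝ} (ht : 0 < t) (s : ℂ) :
    ‖(t : ℂ) ^ (s - 1)‖ = t ^ (s.re - 1) := by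
  rw [Complex.norm_cpow_eq_rpow_re_of_pos ht]
  simp

theorem integrable_rpow_mul_exp {a u : ℝ} (ha : 0 < a) (hu : 0 < u) :
    Integrable (fun ξ : ℝ => ξ ^ (a - 1) * Real.exp (-(u * ξ))) volPlus := by
  have h := integrableOn_rpow_mul_exp_neg_mul_rpow (s := a - 1) (by linarith) one_pos hu
  simp only [Real.rpow_one, neg_mul] at h
  exact h

theorem measurable_cpow_ofReal (s : ℂ) : Measurable fun ξ : ℝ => (ξ : ℂ) ^ s := by
  fun_prop

theorem integrable_cpow_mul_exp {s : ℂ} (hs : 0 < s.re) {u : ℝ} (hu : 0 < u) :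
    Integrable (fun ξ : ℝ => (ξ : ℂ) ^ (s - 1) * Complex.exp (-(u * ξ))) volPlus := by
  refine (integrable_rpow_mul_exp hs hu).mono'
    (((measurable_cpow_ofReal _).mul (by fun_prop)).aestronglyMeasurable) ?_
  filter_upwards [ae_volPlus_pos] with ξ hξ
  rw [norm_mul, norm_cpow_sub_one hξ, Complex.norm_exp]
  simp

/-- Powers are generalized eigenfunctions of the kernel `1 / (ξ + t)`. -/
theorem integral_cpow_div_add {s : ℂ} (h0 : 0 < s.re) (h1 : s.re < 1) {t : ℝ} (ht : 0 < t) :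
    Integrable (fun ξ : ℝ => (ξ : ℂ) ^ (s - 1) / ((ξ + t : ℝ) : ℂ)) volPlus ∧
      ∫ ξ, (ξ : ℂ) ^ (s - 1) / ((ξ + t : ℝ) : ℂ) ∂volPlus
        = (t : ℂ) ^ (s - 1) * (Complex.Gamma s * Complex.Gamma (1 - s)) := by
  -- Write `1/(ξ + t) = ∫₀^∞ e^{-u(ξ+t)} du` and swap: the `ξ`-integral gives `Γ(s) u^{-s}`, and the
  -- `u`-integral then gives `Γ(1-s) t^{s-1}`.
  set f : ℝ → ℝ → ℂ := fun u ξ =>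
    Complex.exp (-(t * u)) * ((ξ : ℂ) ^ (s - 1) * Complex.exp (-(u * ξ))) with hf
  have hm : AEStronglyMeasurable (Function.uncurry f) volQuad := by
    have h2 : Measurable fun p : ℝ × ℝ => (p.2 : ℂ) ^ (s - 1) :=
      (measurable_cpow_ofReal (s - 1)).comp measurable_snd
    have h3 : Measurable fun p : ℝ × ℝ => Complex.exp (-(t * p.1)) := by fun_prop
    have h4 : Measurable fun p : ℝ × ℝ => Complex.exp (-(p.1 * p.2)) := by fun_prop
    exact (h3.mul (h2.mul h4)).aestronglyMeasurable
  have hint : Integrable (Function.uncurry f) volQuad := by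
    rw [integrable_prod_iff hm]
    constructor
    · filter_upwards [ae_volPlus_pos] with u hu
      exact (integrable_cpow_mul_exp h0 hu).const_mul (Complex.exp (-(t * u)))
    · have h2 := (integrable_rpow_mul_exp (a := 1 - s.re) (by linarith) ht).const_mul
        (Real.Gamma s.re)
      refine h2.congr ?_
      filter_upwards [ae_volPlus_pos] with u hu
      have h3 : ∫ ξ, ‖Function.uncurry f (u, ξ)‖ ∂volPlus
          = ∫ ξ, Real.exp (-(t * u)) * (ξ ^ (s.re - 1) * Real.exp (-(u * ξ))) ∂volPlus := by
        refine integral_congr_ae ?_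
        filter_upwards [ae_volPlus_pos] with ξ hξ
        simp only [Function.uncurry_apply_pair, hf]
        rw [norm_mul, norm_mul, norm_cpow_sub_one hξ, Complex.norm_exp, Complex.norm_exp]
        simp
      rw [h3, integral_const_mul, Real.integral_rpow_mul_exp_neg_mul_Ioi h0 hu, one_div,
        Real.inv_rpow hu.le, ← Real.rpow_neg hu.le]
      have : 1 - s.re - 1 = -s.re := by ring
      rw [this]
      ring
  have hinner : ∀ ξ : ℝ, 0 < ξ →
      ∫ u, f u ξ ∂volPlus = (ξ : ℂ) ^ (s - 1) / ((ξ + t : ℝ) : ℂ) := by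
    intro ξ hξ
    have hre : (-((ξ + t : ℝ) : ℂ)).re < 0 := by
      rw [Complex.neg_re, Complex.ofReal_re]
      linarith
    have h2 := integral_exp_mul_complex_Ioi hre 0
    have h3 : ∀ u : ℝ, f u ξ = (ξ : ℂ) ^ (s - 1) * Complex.exp (-((ξ + t : ℝ) : ℂ) * u) := by
      intro u
      have : Complex.exp (-((ξ + t : ℝ) : ℂ) * u)
          = Complex.exp (-(t * u)) * Complex.exp (-(u * ξ)) := by
        rw [← Complex.exp_add]
        congr 1
        push_cast
        ring
      rw [this]
      simp only [hf]
      ring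
    simp only [h3]
    rw [integral_const_mul, h2, Complex.ofReal_zero, mul_zero, Complex.exp_zero, neg_div_neg_eq,
      mul_one_div]
  have houter : ∀ᵐ ξ ∂volPlus,
      ∫ u, f u ξ ∂volPlus = (ξ : ℂ) ^ (s - 1) / ((ξ + t : ℝ) : ℂ) := by
    filter_upwards [ae_volPlus_pos] with ξ hξ using hinner ξ hξ
  refine ⟨hint.integral_prod_right.congr houter, ?_⟩
  rw [← integral_congr_ae houter, ← integral_integral_swap hint]
  calc ∫ u, ∫ ξ, f u ξ ∂volPlus ∂volPlus
      = ∫ u, Complex.Gamma s * ((u : ℂ) ^ ((1 - s) - 1) * Complex.exp (-(t * u))) ∂volPlus := by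
        refine integral_congr_ae ?_
        filter_upwards [ae_volPlus_pos] with u hu
        simp only [hf]
        rw [integral_const_mul, Complex.integral_cpow_mul_exp_neg_mul_Ioi h0 hu,
          inv_cpow_of_pos hu]
        have : (1 - s) - 1 = -s := by ring
        rw [this]
        ring
    _ = _ := by
        rw [integral_const_mul, Complex.integral_cpow_mul_exp_neg_mul_Ioi (by simpa using h1) ht,
          inv_cpow_of_pos ht, neg_sub]
        ring

/-! ### Powers cut off to the unit interval. -/

theorem volPlus_restrict_Ioo :
    volPlus.restrict (Ioo 0 1) = (volume : Measure ℝ).restrict (Ioo 0 1) := by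
  rw [volPlus, Measure.restrict_restrict measurableSet_Ioo, inter_eq_left.2]
  exact fun t ht => ht.1

theorem integral_rpow_Ioo {a : ℝ} (ha : 0 < a) :
    Integrable (fun t : ℝ => t ^ (a - 1)) (volPlus.restrict (Ioo 0 1)) ∧
      ∫ t, t ^ (a - 1) ∂(volPlus.restrict (Ioo 0 1)) = 1 / a := by
  rw [volPlus_restrict_Ioo]
  constructor
  · have h := intervalIntegral.intervalIntegrable_rpow' (a := 0) (b := 1) (r := a - 1)
      (by linarith)
    rw [intervalIntegrable_iff_integrableOn_Ioo_of_le zero_le_one] at h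
    exact h
  · rw [← integral_Ioc_eq_integral_Ioo, ← intervalIntegral.integral_of_le zero_le_one,
      integral_rpow (Or.inl (by linarith)), sub_add_cancel, Real.one_rpow,
      Real.zero_rpow ha.ne', sub_zero]

/-- The function `t ^ (s - 1)` cut off to `(0, 1)`. -/
def cutPower (s : ℂ) : ℝ → ℂ := (Ioo (0 : ℝ) 1).indicator fun t => (t : ℂ) ^ (s - 1)

theorem measurable_cutPower (s : ℂ) : Measurable (cutPower s) :=
  (measurable_cpow_ofReal _).indicator measurableSet_Ioo

theorem norm_cutPower (s : ℂ) (t : ℝ) :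
    ‖cutPower s t‖ = (Ioo (0 : ℝ) 1).indicator (fun t => t ^ (s.re - 1)) t := by
  by_cases ht : t ∈ Ioo (0 : ℝ) 1
  · rw [cutPower, indicator_of_mem ht, indicator_of_mem ht, norm_cpow_sub_one ht.1]
  · rw [cutPower, indicator_of_notMem ht, indicator_of_notMem ht, norm_zero]

theorem integrable_cutPower {s : ℂ} (hs : 0 < s.re) :
    Integrable (cutPower s) volPlus ∧ ∫ t, ‖cutPower s t‖ ∂volPlus = 1 / s.re := by
  have h := integral_rpow_Ioo hs
  constructor
  · rw [← integrable_norm_iff (measurable_cutPower s).aestronglyMeasurable]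
    simp only [norm_cutPower]
    exact (integrable_indicator_iff measurableSet_Ioo).2 h.1
  · simp only [norm_cutPower]
    rw [integral_indicator measurableSet_Ioo]
    exact h.2

theorem norm_cutPower_sq (s : ℂ) (t : ℝ) :
    ‖cutPower s t‖ ^ 2 = (Ioo (0 : ℝ) 1).indicator (fun t => t ^ ((2 * s.re - 1) - 1)) t := by
  rw [norm_cutPower]
  by_cases ht : t ∈ Ioo (0 : ℝ) 1
  · rw [indicator_of_mem ht, indicator_of_mem ht, ← Real.rpow_natCast, ← Real.rpow_mul ht.1.le]
    congr 1
    push_cast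
    ring
  · rw [indicator_of_notMem ht, indicator_of_notMem ht]
    simp

theorem memLp_cutPower {s : ℂ} (hs : 1 / 2 < s.re) : MemLp (cutPower s) 2 volPlus := by
  rw [memLp_two_iff_integrable_sq_norm (measurable_cutPower s).aestronglyMeasurable]
  simp only [norm_cutPower_sq]
  exact (integrable_indicator_iff measurableSet_Ioo).2
    (integral_rpow_Ioo (by linarith)).1

theorem norm_sq_toLp_cutPower {s : ℂ} (hs : 1 / 2 < s.re) :
    ‖(memLp_cutPower hs).toLp‖ ^ 2 = 1 / (2 * s.re - 1) := by
  rw [norm_sq_eq_integral, ← (integral_rpow_Ioo (a := 2 * s.re - 1) (by linarith)).2,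
    ← integral_indicator measurableSet_Ioo]
  refine integral_congr_ae ?_
  filter_upwards [(memLp_cutPower hs).coeFn_toLp] with t ht
  rw [ht, norm_cutPower_sq]

/-- The error of `cutPower s` as an eigenfunction of the kernel `1 / (ξ + η)`. -/
def cutPowerError (s : ℂ) (η : ℝ) : ℂ :=
  ∫ ξ, cutPower s ξ / ((ξ + η : ℝ) : ℂ) ∂volPlus
    - Complex.Gamma s * Complex.Gamma (1 - s) * cutPower s η

theorem measurable_cutPower_div (s : ℂ) :
    Measurable fun p : ℝ × ℝ => cutPower s p.2 / ((p.2 + p.1 : ℝ) : ℂ) :=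
  ((measurable_cutPower s).comp measurable_snd).div (by fun_prop)

theorem stronglyMeasurable_cutPowerError (s : ℂ) : StronglyMeasurable (cutPowerError s) :=
  ((measurable_cutPower_div s).stronglyMeasurable.integral_prod_right).sub
    ((measurable_cutPower s).stronglyMeasurable.const_mul _)

/-- For `η < 1` the exact eigenfunction identity leaves only the tail over `ξ > 1`, at most `1/(1 -
Re s) ≤ 4`. For `η ≥ 1` the cut-off power vanishes at `η` and the integral is at most `1/(η Re s) ≤
2/η`. The majorant covers both ranges, is square integrable and does not depend on `s`. -/
theorem norm_cutPowerError_le {s : ℂ} (h0 : 1 / 2 < s.re) (h1 : s.re ≤ 3 / 4) {η : ℝ}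
    (hη : 0 < η) : ‖cutPowerError s η‖ ≤ 8 / Real.sqrt (1 + η ^ 2) := by
  have hsq : 0 < Real.sqrt (1 + η ^ 2) := by positivity
  have hcut : ∀ ξ : ℝ, 0 < ξ → ‖cutPower s ξ / ((ξ + η : ℝ) : ℂ)‖ ≤ ‖cutPower s ξ‖ * (1 / η) := by
    intro ξ hξ
    rw [norm_div, Complex.norm_real, Real.norm_of_nonneg (by linarith), div_eq_mul_one_div]
    gcongr
    linarith
  have hci := integrable_cutPower (s := s) (by linarith)
  rcases lt_or_ge η 1 with h | h
  · have hG := integral_cpow_div_add (s := s) (by linarith) (by linarith) hη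
    have hηmem : η ∈ Ioo (0 : ℝ) 1 := ⟨hη, h⟩
    have hint : Integrable (fun ξ => cutPower s ξ / ((ξ + η : ℝ) : ℂ)) volPlus := by
      refine (hci.1.norm.mul_const (1 / η)).mono' ?_ ?_
      · exact ((measurable_cutPower s).div (by fun_prop)).aestronglyMeasurable
      · filter_upwards [ae_volPlus_pos] with ξ hξ using hcut ξ hξ
    have heq : cutPowerError s η = ∫ ξ, (cutPower s ξ / ((ξ + η : ℝ) : ℂ)
        - (ξ : ℂ) ^ (s - 1) / ((ξ + η : ℝ) : ℂ)) ∂volPlus := by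
      rw [integral_sub hint hG.1, hG.2, cutPowerError, cutPower, indicator_of_mem hηmem]
      ring
    have htail : IntegrableOn (fun ξ : ℝ => ξ ^ (s.re - 2)) (Ioi 1) :=
      integrableOn_Ioi_rpow_of_lt (by linarith) one_pos
    have htail2 : ∫ ξ in Ioi (1 : ℝ), ξ ^ (s.re - 2) = 1 / (1 - s.re) := by
      rw [integral_Ioi_rpow_of_lt (by linarith) one_pos, Real.one_rpow, ← neg_div_neg_eq, neg_neg]
      congr 1
      ring
    have hres : volPlus.restrict (Ioi 1) = (volume : Measure ℝ).restrict (Ioi 1) := by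
      rw [volPlus, Measure.restrict_restrict measurableSet_Ioi, inter_eq_left.2]
      exact Ioi_subset_Ioi zero_le_one
    have hb : ‖cutPowerError s η‖ ≤
        ∫ ξ, (Ioi (1 : ℝ)).indicator (fun ξ => ξ ^ (s.re - 2)) ξ ∂volPlus := by
      rw [heq]
      refine norm_integral_le_of_norm_le ?_ ?_
      · rw [integrable_indicator_iff measurableSet_Ioi, IntegrableOn, hres]
        exact htail
      -- At `ξ = 1` neither the cut-off power nor the open tail contributes, so this null point has
      -- to be discarded.
      · have hne : ∀ᵐ ξ ∂volPlus, ξ ≠ 1 := ae_restrict_of_ae (Measure.ae_ne volume 1)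
        filter_upwards [ae_volPlus_pos, hne] with ξ hξ hξ1
        rcases lt_or_gt_of_ne hξ1 with h2 | h2
        · rw [cutPower, indicator_of_mem (show ξ ∈ Ioo (0 : ℝ) 1 from ⟨hξ, h2⟩), sub_self,
            norm_zero]
          exact indicator_nonneg (fun t ht => Real.rpow_nonneg (by
            have : (1 : ℝ) < t := ht
            linarith) _) _
        · rw [cutPower, indicator_of_notMem (fun hh => absurd hh.2 (not_lt.2 h2.le)),
            zero_div, zero_sub, norm_neg, norm_div, norm_cpow_sub_one hξ, Complex.norm_real,
            Real.norm_of_nonneg (by linarith), indicator_of_mem (show ξ ∈ Ioi (1 : ℝ) from h2)]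
          have h3 : ξ ^ (s.re - 2) = ξ ^ (s.re - 1) / ξ := by
            rw [← Real.rpow_sub_one hξ.ne']
            congr 1
            ring
          rw [h3]
          gcongr
          linarith
    rw [integral_indicator measurableSet_Ioi, hres, htail2] at hb
    have h4 : 1 / (1 - s.re) ≤ 4 := by
      rw [div_le_iff₀ (by linarith)]
      linarith
    have h5 : (4 : ℝ) ≤ 8 / Real.sqrt (1 + η ^ 2) := by
      rw [le_div_iff₀ hsq]
      have : Real.sqrt (1 + η ^ 2) ≤ 2 := by
        rw [Real.sqrt_le_left (by norm_num)]
        nlinarith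
      linarith
    linarith
  · have heq : cutPowerError s η = ∫ ξ, cutPower s ξ / ((ξ + η : ℝ) : ℂ) ∂volPlus := by
      rw [cutPowerError]
      conv_lhs => rw [cutPower.eq_def s]
      rw [indicator_of_notMem (fun hh : η ∈ Ioo (0 : ℝ) 1 => absurd hh.2 (not_lt.2 h))]
      simp [cutPower]
    have hb : ‖cutPowerError s η‖ ≤ ∫ ξ, ‖cutPower s ξ‖ * (1 / η) ∂volPlus := by
      rw [heq]
      refine norm_integral_le_of_norm_le (hci.1.norm.mul_const _) ?_
      filter_upwards [ae_volPlus_pos] with ξ hξ using hcut ξ hξ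
    rw [integral_mul_const, hci.2] at hb
    have h2 : 1 / s.re ≤ 2 := by
      rw [div_le_iff₀ (by linarith)]
      linarith
    have h3 : 2 * (1 / η) ≤ 8 / Real.sqrt (1 + η ^ 2) := by
      rw [mul_one_div, div_le_div_iff₀ hη hsq]
      have : Real.sqrt (1 + η ^ 2) ≤ 2 * η := by
        rw [Real.sqrt_le_left (by linarith)]
        nlinarith
      linarith
    have h4 : 1 / s.re * (1 / η) ≤ 2 * (1 / η) := by gcongr
    linarith

theorem memLp_errorBound :
    MemLp (fun η : ℝ => ((8 / Real.sqrt (1 + η ^ 2) : ℝ) : ℂ)) 2 volPlus := by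
  have hm : Measurable fun η : ℝ => ((8 / Real.sqrt (1 + η ^ 2) : ℝ) : ℂ) := by fun_prop
  rw [memLp_two_iff_integrable_sq_norm hm.aestronglyMeasurable]
  have h := (integrable_inv_one_add_sq.restrict (s := Ioi (0 : ℝ))).const_mul 64
  refine h.congr (Eventually.of_forall fun η => ?_)
  simp only
  rw [Complex.norm_real, Real.norm_of_nonneg (by positivity), div_pow,
    Real.sq_sqrt (by positivity), div_eq_mul_inv]
  norm_num

theorem memLp_cutPowerError {s : ℂ} (h0 : 1 / 2 < s.re) (h1 : s.re ≤ 3 / 4) :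
    MemLp (cutPowerError s) 2 volPlus := by
  refine memLp_errorBound.mono (stronglyMeasurable_cutPowerError s).aestronglyMeasurable ?_
  filter_upwards [ae_volPlus_pos] with η hη
  rw [Complex.norm_real, Real.norm_of_nonneg (by positivity)]
  exact norm_cutPowerError_le h0 h1 hη

/-- The square is known only weakly, so the identity is tested against integrable `y`; integrating
over `ξ` first makes the eigenvalue term and the error appear. -/
theorem truncatedFourier_sq_cutPower {s : ℂ} (h0 : 1 / 2 < s.re) (h1 : s.re ≤ 3 / 4) :
    truncatedFourier (truncatedFourier (memLp_cutPower h0).toLp)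
      = (Complex.I / (2 * Real.pi)) •
        ((Complex.Gamma s * Complex.Gamma (1 - s)) • (memLp_cutPower h0).toLp
          + (memLp_cutPowerError h0 h1).toLp) := by
  set x : L2Plus := (memLp_cutPower h0).toLp with hx
  have hxc : x =ᵐ[volPlus] cutPower s := (memLp_cutPower h0).coeFn_toLp
  have hxi : Integrable x volPlus :=
    (integrable_cutPower (by linarith)).1.congr hxc.symm
  refine eq_of_pairing_eq fun y hy => ?_
  rw [pairing_truncatedFourier_sq x y hxi hy, map_smul, smul_apply,
    smul_eq_mul, integral_prod_symm _ (integrable_carleman x y), pairing_apply]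
  congr 1
  refine integral_congr_ae ?_
  filter_upwards [hxc, (memLp_cutPowerError h0 h1).coeFn_toLp,
    Lp.coeFn_add ((Complex.Gamma s * Complex.Gamma (1 - s)) • x)
      (memLp_cutPowerError h0 h1).toLp,
    Lp.coeFn_smul (Complex.Gamma s * Complex.Gamma (1 - s)) x] with η h2 h3 h4 h5
  rw [h4, Pi.add_apply, h5, Pi.smul_apply, h2, h3, cutPowerError, smul_eq_mul, add_sub_cancel,
    ← integral_mul_const]
  refine integral_congr_ae ?_
  filter_upwards [hxc] with ξ h6
  rw [h6]
  ring

/-- The transform is bounded pointwise by the `L¹` norm. For cut-off powers that norm stays bounded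
as `Re s` decreases to `1/2`, while the `L²` norm does not. -/
theorem norm_inner_truncatedFourier_le (x : L2Plus) (hx : Integrable x volPlus) :
    ‖inner ℂ x (truncatedFourier x)‖ ≤ (∫ t, ‖x t‖ ∂volPlus) ^ 2 := by
  set N := ∫ t, ‖x t‖ ∂volPlus with hN
  rw [L2.inner_def, pow_two]
  nth_rewrite 1 [hN]
  rw [← integral_mul_const]
  refine norm_integral_le_of_norm_le (hx.norm.mul_const _) ?_
  filter_upwards [truncatedFourier_coeFn x hx, ae_volPlus_pos] with t ht htp
  refine (norm_inner_le_norm _ _).trans ?_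
  gcongr
  rw [ht, norm_mul]
  have h1 : ‖((Real.sqrt (2 * Real.pi))⁻¹ : ℂ)‖ ≤ 1 := by
    rw [norm_inv, Complex.norm_real, Real.norm_of_nonneg (Real.sqrt_nonneg _)]
    refine inv_le_one_of_one_le₀ ?_
    rw [Real.one_le_sqrt]
    linarith [Real.pi_gt_three]
  have h2 : ‖laplace (-Complex.I) x t‖ ≤ N := by
    rw [hN]
    refine norm_integral_le_of_norm_le hx.norm ?_
    filter_upwards [ae_volPlus_pos] with ξ hξ
    rw [norm_mul]
    exact mul_le_of_le_one_right (norm_nonneg _)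
      (norm_exp_neg_le_one (by simp) hξ.le htp.le)
  calc _ ≤ 1 * N := by gcongr
    _ = N := one_mul N

theorem norm_inner_cutPower_le {s : ℂ} (h0 : 1 / 2 < s.re) :
    ‖inner ℂ (memLp_cutPower h0).toLp (truncatedFourier (memLp_cutPower h0).toLp)‖ ≤ 4 := by
  have hxc := (memLp_cutPower h0).coeFn_toLp
  have hc := integrable_cutPower (s := s) (by linarith)
  refine (norm_inner_truncatedFourier_le _ (hc.1.congr hxc.symm)).trans ?_
  have h1 : ∫ t, ‖((memLp_cutPower h0).toLp : L2Plus) t‖ ∂volPlus = 1 / s.re := by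
    rw [← hc.2]
    refine integral_congr_ae ?_
    filter_upwards [hxc] with t ht
    rw [ht]
  have h2 : 1 / s.re ≤ 2 := by
    rw [div_le_iff₀ (by linarith)]
    linarith
  rw [h1]
  have h3 : 0 < 1 / s.re := by
    have : 0 < s.re := by linarith
    positivity
  nlinarith

theorem truncatedFourier_approx (μ : ℝ) {ε : ℝ} (hε : 0 < ε) :
    ∃ x : L2Plus, x ≠ 0 ∧ ‖truncatedFourier (truncatedFourier x) -
      (Complex.I / (2 * Real.cosh (Real.pi * μ) : ℝ)) • x‖ ≤ ε * ‖x‖ ∧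
      ‖inner ℂ x (truncatedFourier x)‖ ≤ ε * ‖x‖ ^ 2 := by
  set C : ℝ := ‖(memLp_errorBound.toLp : L2Plus)‖ with hC
  set s : ℝ → ℂ := fun δ => 1 / 2 + δ + Complex.I * μ with hs
  have hre : ∀ δ, (s δ).re = 1 / 2 + δ := fun δ => by simp [hs]
  set κ : ℝ → ℂ := fun δ =>
    Complex.I / (2 * Real.pi) * (Complex.Gamma (s δ) * Complex.Gamma (1 - s δ)) with hκ
  have hκ0 : κ 0 = Complex.I / (2 * Real.cosh (Real.pi * μ) : ℝ) := by
    have hconj : (1 - s 0 : ℂ) = (starRingEnd ℂ) (1 / 2 + Complex.I * μ) := by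
      apply Complex.ext <;> simp [hs]
      norm_num
    have hs0 : s 0 = 1 / 2 + Complex.I * μ := by simp [hs]
    have hp : (Real.pi : ℂ) ≠ 0 := Complex.ofReal_ne_zero.2 Real.pi_ne_zero
    simp only [hκ]
    rw [hconj, hs0, Complex.Gamma_conj, Complex.mul_conj, Complex.normSq_eq_norm_sq,
      norm_Gamma_half_sq]
    simp only [Complex.ofReal_div, Complex.ofReal_mul, Complex.ofReal_ofNat]
    field_simp
  have hcont : ContinuousAt κ 0 := by
    have hsc : Continuous s := by fun_prop
    have hG : ∀ z : ℂ, 0 < z.re → ContinuousAt Complex.Gamma z := by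
      intro z hz
      refine (Complex.differentiableAt_Gamma z fun m hm => ?_).continuousAt
      rw [hm] at hz
      simp only [Complex.neg_re, Complex.natCast_re] at hz
      linarith [(m.cast_nonneg : (0 : ℝ) ≤ m)]
    refine continuousAt_const.mul (ContinuousAt.mul ?_ ?_)
    · exact (hG _ (by rw [hre]; norm_num)).comp hsc.continuousAt
    · exact (hG (1 - s 0) (by rw [Complex.sub_re, hre]; norm_num)).comp
        (f := fun δ => 1 - s δ) (by fun_prop)
  have e1 : ∀ᶠ δ in nhdsWithin (0 : ℝ) (Ioi 0), ‖κ δ - κ 0‖ ≤ ε / 2 := by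
    have h1 := (Metric.continuousAt_iff'.1 hcont (ε / 2) (by positivity)).filter_mono
      (nhdsWithin_le_nhds (s := Ioi (0 : ℝ)))
    filter_upwards [h1] with δ h2
    rw [dist_eq_norm] at h2
    exact h2.le
  have hinv : Tendsto (fun δ : ℝ => 1 / (2 * δ)) (nhdsWithin (0 : ℝ) (Ioi 0)) atTop := by
    have h1 : Tendsto (fun δ : ℝ => δ⁻¹ * (1 / 2)) (nhdsWithin (0 : ℝ) (Ioi 0)) atTop :=
      tendsto_inv_nhdsGT_zero.atTop_mul_const (by norm_num)
    refine h1.congr fun δ => ?_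
    rw [one_div, one_div, mul_inv, mul_comm]
  -- Here `1/(2δ)` will be `‖x‖²`. The first threshold gives `4 ≤ ε‖x‖²`, where `4` bounds `|⟨x,
  -- Ax⟩|`; the second gives `C ≤ (ε/2)‖x‖` for the error. Then `δ ≤ 1/4` keeps `Re s ≤ 3/4`.
  have e2 := hinv.eventually_ge_atTop (4 / ε)
  have e3 := hinv.eventually_ge_atTop ((2 * C / ε) ^ 2)
  have e4 : ∀ᶠ δ in nhdsWithin (0 : ℝ) (Ioi 0), δ ≤ 1 / 4 :=
    (eventually_le_nhds (by norm_num : (0 : ℝ) < 1 / 4)).filter_mono nhdsWithin_le_nhds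
  have e5 : ∀ᶠ δ in nhdsWithin (0 : ℝ) (Ioi 0), 0 < δ := self_mem_nhdsWithin
  obtain ⟨δ, h1, h2, h3, h4, h5⟩ := (e1.and (e2.and (e3.and (e4.and e5)))).exists
  have hb0 : 1 / 2 < (s δ).re := by rw [hre]; linarith
  have hb1 : (s δ).re ≤ 3 / 4 := by rw [hre]; linarith
  set x : L2Plus := (memLp_cutPower hb0).toLp with hx
  have hn : ‖x‖ ^ 2 = 1 / (2 * δ) := by
    rw [hx, norm_sq_toLp_cutPower hb0, hre]
    congr 1
    ring
  have hxn : 0 < ‖x‖ := by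
    refine lt_of_le_of_ne (norm_nonneg _) fun h => ?_
    rw [← h] at hn
    have : 0 < 1 / (2 * δ) := by positivity
    rw [← hn] at this
    norm_num at this
  refine ⟨x, norm_pos_iff.1 hxn, ?_, ?_⟩
  · have hE : ‖(memLp_cutPowerError hb0 hb1).toLp‖ ≤ C := by
      refine Lp.norm_le_norm_of_ae_le ?_
      filter_upwards [(memLp_cutPowerError hb0 hb1).coeFn_toLp, memLp_errorBound.coeFn_toLp,
        ae_volPlus_pos] with η h6 h7 h8
      rw [h6, h7, Complex.norm_real, Real.norm_of_nonneg (by positivity)]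
      exact norm_cutPowerError_le hb0 hb1 h8
    have hCx : C ≤ ε / 2 * ‖x‖ := by
      rw [← hn] at h3
      have h6 := le_of_sq_le_sq h3 hxn.le
      rw [div_le_iff₀ hε] at h6
      linarith
    have hI : ‖(Complex.I / (2 * Real.pi) : ℂ)‖ ≤ 1 := by
      rw [norm_div, Complex.norm_I, norm_mul, Complex.norm_real,
        Real.norm_of_nonneg Real.pi_pos.le, Complex.norm_ofNat,
        div_le_one (by have := Real.pi_pos; positivity)]
      linarith [Real.pi_gt_three]
    -- Two sources of error: the eigenvalue at `s δ` in place of its limit at `δ = 0`, and the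
    -- cut-off; each receives half of `ε`.
    have hd : truncatedFourier (truncatedFourier x) - κ 0 • x
        = (κ δ - κ 0) • x +
          (Complex.I / (2 * Real.pi) : ℂ) • (memLp_cutPowerError hb0 hb1).toLp := by
      rw [hx, truncatedFourier_sq_cutPower hb0 hb1, smul_add, smul_smul, sub_smul]
      abel
    rw [← hκ0, hd]
    calc _ ≤ ‖(κ δ - κ 0) • x‖ +
          ‖(Complex.I / (2 * Real.pi) : ℂ) • (memLp_cutPowerError hb0 hb1).toLp‖ :=
          norm_add_le _ _
      _ ≤ ε / 2 * ‖x‖ + 1 * C := by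
          rw [norm_smul, norm_smul]
          gcongr
      _ ≤ ε * ‖x‖ := by linarith
  · rw [hn]
    refine (norm_inner_cutPower_le hb0).trans ?_
    rw [div_le_iff₀ hε] at h2
    linarith

theorem spectrum_truncatedFourier :
    spectrum ℂ truncatedFourier = segment ℝ (-endpoint) endpoint :=
  spectrum_eq_segment truncatedFourier truncatedFourier_sq_form
    fun μ _ _ hε => truncatedFourier_approx μ hε

end TruncatedFourier

end

theorem theorem4p2 :
    spectrum ℂ TruncatedFourier.modelOperator
        = segment ℝ (-TruncatedFourier.endpoint) TruncatedFourier.endpoint ∧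
    spectrum ℂ TruncatedFourier.truncatedFourier
        = segment ℝ (-TruncatedFourier.endpoint) TruncatedFourier.endpoint ∧
    (∀ μ : ℝ≥0∞, spectrum ℂ (TruncatedFourier.Fext μ)
        = {TruncatedFourier.zeta μ, -TruncatedFourier.zeta μ}) ∧
    spectrum ℂ TruncatedFourier.modelOperator
        = ⋃ μ : ℝ≥0∞, spectrum ℂ (TruncatedFourier.Fext μ) ∧
    spectrum ℂ TruncatedFourier.modelOperator
        = ⋃ μ : ℝ≥0∞, {TruncatedFourier.zeta μ, -TruncatedFourier.zeta μ} ∧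
    spectralRadius ℂ TruncatedFourier.modelOperator = ENNReal.ofReal (1 / Real.sqrt 2) ∧
    spectralRadius ℂ TruncatedFourier.truncatedFourier = ENNReal.ofReal (1 / Real.sqrt 2) := by
  open TruncatedFourier in
  refine ⟨spectrum_modelOperator, spectrum_truncatedFourier, spectrum_Fext, ?_, ?_,
    spectralRadius_of_spectrum_eq_segment _ spectrum_modelOperator,
    spectralRadius_of_spectrum_eq_segment _ spectrum_truncatedFourier⟩
  · simp only [TruncatedFourier.spectrum_Fext]
    rw [TruncatedFourier.spectrum_modelOperator,
      TruncatedFourier.segment_endpoint_eq_iUnion_zeta]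
  · rw [TruncatedFourier.spectrum_modelOperator,
      TruncatedFourier.segment_endpoint_eq_iUnion_zeta]
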